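/- There is a universal constant $C>0$ such that for every $c\in\mathbb R$ there is an $n_0=n_0(c)$ for which the following holds for all $n>n_0$, all $\eta$ with $n^{-c}<\eta<1/2$, and all $1\le d\le n$. Let $F$ be a probability distribution on a set $\mathcal X\subset\mathbb R^d$ with $\langle x,x'\rangle\in[0,1]$ for all $x,x'\in\mathcal X$, whose second moment matrix $\Delta=\mathbb E_{X_1\sim F}[X_1X_1^\top]$ has distinct and positive eigenvalues, and let $\delta_d$ be the smallest of them. Let $(X,A)\sim\mathrm{RDPG}(F)$ be a random dot product graph on $n$ vertices: $X_1,\dots,X_n$ are independent with law $F$, $X=[X_1,\dots,X_n]^\top\in\mathbb R^{n\times d}$, $P=XX^\top$, and $A\in\{0,1\}^{n\times n}$ is symmetric and hollow (zero diagonal) with entries $A_{ij}$, $i<j$, that are, conditionally on $X$, independent Bernoulli variables with parameters $X_i^\top X_j$. Let $S$ be the $d\times d$ diagonal matrix of the $d$ largest eigenvalues of $P$ in decreasing order, and let $\hat S$ be the $d\times d$ diagonal matrix of the $d$ largest eigenvalues in magnitude of $A$ in order of decreasing magnitude (eigenvalues are counted with multiplicity; ties in magnitude may be broken in any way). Then,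 with probability greater than $1-2\eta$, $$\|S-\hat S\|_F\le C\,\delta_d^{-2}\,d\,\log(n/\eta),$$ where $\|\cdot\|_F$ is the Frobenius norm. -/

import Mathlib

open MeasureTheory ProbabilityTheory
open scoped Matrix Matrix.Norms.Frobenius

noncomputable section

/-- The probability that a Bernoulli variable of parameter `p` assigns to the value `v`,
for `v ∈ {0, 1}`. -/
def bernoulliWeight (p v : ℝ) : ℝ := if v = 1 then p else 1 - p

/-- `(X, A) ∼ RDPG(F)` on `n` vertices. The latent positions `X i` are independent with law `F`,
and `A` is a symmetric, hollow matrix with entries in `{0, 1}` whose entries above the diagonal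
are, conditionally on the latent positions, independent Bernoulli variables of parameters
`⟪X i, X j⟫`: the conditional probability of each `0`-`1` pattern above the diagonal is the
product of the corresponding Bernoulli weights. -/
structure IsRDPG {Ω : Type*} [MeasurableSpace Ω] (μ : Measure Ω) {n d : ℕ}
    (F : Measure (EuclideanSpace ℝ (Fin d)))
    (X : Fin n → Ω → EuclideanSpace ℝ (Fin d))
    (A : Ω → Matrix (Fin n) (Fin n) ℝ) : Prop where
  measurable_latent : ∀ i, Measurable (X i)
  latent_law : ∀ i, μ.map (X i) = F
  latent_indep : iIndepFun X μ
  measurable_adj : ∀ i j, Measurable fun ω => A ω i j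
  adj_zero_or_one : ∀ ω i j, A ω i j = 0 ∨ A ω i j = 1
  adj_symm : ∀ ω, (A ω).IsSymm
  adj_hollow : ∀ ω i, A ω i i = 0
  adj_cond : ∀ a : Fin n → Fin n → ℝ, (∀ i j, a i j = 0 ∨ a i j = 1) →
    μ⟦{ω | ∀ i j, i < j → A ω i j = a i j} |
        MeasurableSpace.comap (fun ω i => X i ω) inferInstance⟧
      =ᵐ[μ] fun ω => ∏ i, ∏ j ∈ Finset.Ioi i, bernoulliWeight (inner ℝ (X i ω) (X j ω)) (a i j)

/-- The `n × d` matrix whose `i`-th row is `x i`. -/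
def latentMatrix {n d : ℕ} (x : Fin n → EuclideanSpace ℝ (Fin d)) : Matrix (Fin n) (Fin d) ℝ :=
  Matrix.of fun i k => x i k

/-- The matrix `P = X Xᵀ`. -/
def probMatrix {n d : ℕ} (x : Fin n → EuclideanSpace ℝ (Fin d)) : Matrix (Fin n) (Fin n) ℝ :=
  latentMatrix x * (latentMatrix x)ᵀ

/-- The second moment matrix `Δ = 𝔼[X₁ X₁ᵀ]` of a distribution on `ℝᵈ`. -/
def secondMoment {d : ℕ} (F : Measure (EuclideanSpace ℝ (Fin d))) : Matrix (Fin d) (Fin d) ℝ :=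
  Matrix.of fun k l => ∫ x, x k * x l ∂F

theorem secondMoment_isHermitian {d : ℕ} (F : Measure (EuclideanSpace ℝ (Fin d))) :
    (secondMoment F).IsHermitian := by
  ext k l
  simp [secondMoment, mul_comm]

/-- The eigenvalues of the second moment matrix, with multiplicity. -/
def momentEigenvalues {d : ℕ} (F : Measure (EuclideanSpace ℝ (Fin d))) : Fin d → ℝ :=
  (secondMoment_isHermitian F).eigenvalues

/-- `S` is the diagonal matrix of the `d` largest eigenvalues in magnitude of the symmetric matrix
`M`, with multiplicity and listed by decreasing magnitude: there is a full spectral decomposition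
`M = U diag(ev) Uᵀ` with `|ev 0| ≥ |ev 1| ≥ ⋯` whose first `d` eigenvalues form the diagonal of
`S`. For a positive semidefinite `M` these are the `d` largest eigenvalues in decreasing order. -/
def IsTopEigenvalueMatrix {n d : ℕ} (hdn : d ≤ n) (M : Matrix (Fin n) (Fin n) ℝ)
    (S : Matrix (Fin d) (Fin d) ℝ) : Prop :=
  ∃ U ∈ Matrix.orthogonalGroup (Fin n) ℝ, ∃ ev : Fin n → ℝ,
    M = U * Matrix.diagonal ev * Uᵀ ∧ Antitone (fun i => |ev i|) ∧
      S = Matrix.diagonal fun k : Fin d => ev (Fin.castLE hdn k)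

/-- Every symmetric matrix has such a matrix `S`. -/
theorem exists_isTopEigenvalueMatrix {n d : ℕ} (hdn : d ≤ n) (M : Matrix (Fin n) (Fin n) ℝ) (hM : M.IsHermitian) :
    ∃ S, IsTopEigenvalueMatrix hdn M S := by
  let σ := Tuple.sort (fun i => -|hM.eigenvalues i|)
  have hσ : Monotone ((fun i => -|hM.eigenvalues i|) ∘ σ) := Tuple.monotone_sort _
  let U : Matrix (Fin n) (Fin n) ℝ := (hM.eigenvectorUnitary : Matrix _ _ ℝ).submatrix id σ
  have hu := hM.eigenvectorUnitary.2
  rw [Matrix.mem_unitaryGroup_iff] at hu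
  have h1 := hM.spectral_theorem
  refine ⟨_, U, ?_, hM.eigenvalues ∘ σ, ?_, ?_, rfl⟩
  · rw [Matrix.mem_orthogonalGroup_iff]
    ext i j
    have := congrFun (congrFun hu i) j
    rw [← this]
    simp only [Matrix.mul_apply, U, Matrix.submatrix_apply, id, Matrix.star_apply]
    exact Equiv.sum_comp σ (fun x => (hM.eigenvectorUnitary : Matrix _ _ ℝ) i x * star ((hM.eigenvectorUnitary : Matrix _ _ ℝ) j x))
  · conv_lhs => rw [h1]
    ext i j
    simp only [Unitary.conjStarAlgAut_apply, Matrix.mul_apply (M := _ * Matrix.diagonal _), U, Matrix.submatrix_apply, id, Matrix.mul_diagonal, Matrix.transpose_apply, Function.comp_apply]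
    exact (Equiv.sum_comp σ (fun x => (hM.eigenvectorUnitary : Matrix _ _ ℝ) i x * hM.eigenvalues x * (hM.eigenvectorUnitary : Matrix _ _ ℝ) j x)).symm
  · intro i j hij
    have := hσ hij
    simp at this ⊢
    exact this

end

/-! ### Counting eigenvalues through quadratic forms -/

theorem dotProduct_self_eq_sum_sq_transpose_mulVec {n : ℕ} {U : Matrix (Fin n) (Fin n) ℝ}
    (hU : U ∈ Matrix.orthogonalGroup (Fin n) ℝ) (x : Fin n → ℝ) :
    x ⬝ᵥ x = ∑ i, ((Uᵀ *ᵥ x) i) ^ 2 := by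
  have h1 : U * Uᵀ = 1 := (Matrix.mem_orthogonalGroup_iff (Fin n) ℝ).1 hU
  have : (Uᵀ *ᵥ x) ⬝ᵥ (Uᵀ *ᵥ x) = x ⬝ᵥ x := by
    rw [Matrix.dotProduct_mulVec, ← Matrix.mulVec_transpose, Matrix.transpose_transpose,
      Matrix.mulVec_mulVec, h1, Matrix.one_mulVec]
  rw [← this]
  simp [dotProduct, sq]

theorem dotProduct_mulVec_spectral {n : ℕ} (U : Matrix (Fin n) (Fin n) ℝ) (ev : Fin n → ℝ)
    (x : Fin n → ℝ) :
    x ⬝ᵥ ((U * Matrix.diagonal ev * Uᵀ) *ᵥ x) = ∑ i, ev i * ((Uᵀ *ᵥ x) i) ^ 2 := by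
  rw [← Matrix.mulVec_mulVec, ← Matrix.mulVec_mulVec, Matrix.dotProduct_mulVec,
    ← Matrix.mulVec_transpose]
  simp only [dotProduct, Matrix.mulVec_diagonal]
  exact Finset.sum_congr rfl fun i _ => by ring

theorem eq_zero_of_dotProduct_self {n : ℕ} {x : Fin n → ℝ} (h : x ⬝ᵥ x = 0) : x = 0 :=
  dotProduct_self_eq_zero.1 h

/-- If the quadratic form of `U diag(ev) Uᵀ` is at least `r` times the square norm on the image
under an injective map `f` of the kernel of `g : V → ℝᵗ`, then at least `dim V - |t|` of the
eigenvalues are at least `r`. -/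
theorem finrank_le_card_add_card_le_eigenvalue {n : ℕ} {U : Matrix (Fin n) (Fin n) ℝ}
    (hU : U ∈ Matrix.orthogonalGroup (Fin n) ℝ) (ev : Fin n → ℝ) (r : ℝ)
    {V t : Type*} [AddCommGroup V] [Module ℝ V] [FiniteDimensional ℝ V] [Fintype t]
    (f : V →ₗ[ℝ] Fin n → ℝ) (hf : Function.Injective f) (g : V →ₗ[ℝ] t → ℝ)
    (h : ∀ v, g v = 0 →
      r * (f v ⬝ᵥ f v) ≤ f v ⬝ᵥ ((U * Matrix.diagonal ev * Uᵀ) *ᵥ f v)) :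
    Module.finrank ℝ V ≤ Fintype.card t + (Finset.univ.filter fun i => r ≤ ev i).card := by
  let q : V →ₗ[ℝ] ({i : Fin n // r ≤ ev i} → ℝ) :=
    (LinearMap.funLeft ℝ ℝ Subtype.val) ∘ₗ Uᵀ.mulVecLin ∘ₗ f
  have hinj : Function.Injective (g.prod q) := by
    rw [injective_iff_map_eq_zero]
    intro v hv
    have hg : g v = 0 := congrArg Prod.fst hv
    have hq : q v = 0 := congrArg Prod.snd hv
    have hz : ∀ i, r ≤ ev i → (Uᵀ *ᵥ f v) i = 0 := fun i hi => congrFun hq ⟨i, hi⟩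
    have h1 := h v hg
    rw [dotProduct_mulVec_spectral, dotProduct_self_eq_sum_sq_transpose_mulVec hU,
      Finset.mul_sum] at h1
    have h2 : ∀ i ∈ Finset.univ, ev i * ((Uᵀ *ᵥ f v) i) ^ 2 ≤ r * ((Uᵀ *ᵥ f v) i) ^ 2 := by
      intro i _
      by_cases hi : r ≤ ev i
      · simp [hz i hi]
      · exact mul_le_mul_of_nonneg_right (not_le.1 hi).le (sq_nonneg _)
    have h3 := (Finset.sum_eq_sum_iff_of_le h2).1 (le_antisymm (Finset.sum_le_sum h2) h1)
    have h4 : ∀ i, ((Uᵀ *ᵥ f v) i) ^ 2 = 0 := by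
      intro i
      by_cases hi : r ≤ ev i
      · simp [hz i hi]
      · by_contra hne
        exact (not_le.1 hi).ne (mul_right_cancel₀ hne (h3 i (Finset.mem_univ i)))
    apply hf
    rw [map_zero]
    apply eq_zero_of_dotProduct_self
    rw [dotProduct_self_eq_sum_sq_transpose_mulVec hU]
    exact Finset.sum_eq_zero fun i _ => h4 i
  have := LinearMap.finrank_le_finrank_of_injective hinj
  rw [Module.finrank_prod, Module.finrank_fintype_fun_eq_card,
    Module.finrank_fintype_fun_eq_card, Fintype.card_subtype] at this
  exact this

/-- The version of `finrank_le_card_add_card_le_eigenvalue` for upper bounds. -/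
theorem finrank_le_card_add_card_eigenvalue_le {n : ℕ} {U : Matrix (Fin n) (Fin n) ℝ}
    (hU : U ∈ Matrix.orthogonalGroup (Fin n) ℝ) (ev : Fin n → ℝ) (r : ℝ)
    {V t : Type*} [AddCommGroup V] [Module ℝ V] [FiniteDimensional ℝ V] [Fintype t]
    (f : V →ₗ[ℝ] Fin n → ℝ) (hf : Function.Injective f) (g : V →ₗ[ℝ] t → ℝ)
    (h : ∀ v, g v = 0 →
      f v ⬝ᵥ ((U * Matrix.diagonal ev * Uᵀ) *ᵥ f v) ≤ r * (f v ⬝ᵥ f v)) :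
    Module.finrank ℝ V ≤ Fintype.card t + (Finset.univ.filter fun i => ev i ≤ r).card := by
  have := finrank_le_card_add_card_le_eigenvalue hU (fun i => -ev i) (-r) f hf g (by
    intro v hv
    have h1 := h v hv
    rw [dotProduct_mulVec_spectral] at h1 ⊢
    simp only [neg_mul, Finset.sum_neg_distrib]
    linarith)
  simpa using this

/-- A property that holds for more than `k` indices holds for one that is at least `k`. -/
theorem exists_ge_of_lt_card_filter {n : ℕ} (q : Fin n → Prop) [DecidablePred q] (k : Fin n)
    (h : (k : ℕ) < (Finset.univ.filter q).card) : ∃ i, k ≤ i ∧ q i := by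
  by_contra! hc
  have : Finset.univ.filter q ⊆ Finset.Iio k := by
    intro i hi
    rw [Finset.mem_Iio]
    by_contra hk
    exact hc i (not_lt.1 hk) (Finset.mem_filter.1 hi).2
  have := Finset.card_le_card this
  rw [Fin.card_Iio] at this
  omega

/-- A property that holds for at least `n - k` indices holds for one that is at most `k`. -/
theorem exists_le_of_le_add_card_filter {n : ℕ} (q : Fin n → Prop) [DecidablePred q] (k : Fin n)
    (h : n ≤ k + (Finset.univ.filter q).card) : ∃ i, i ≤ k ∧ q i := by
  by_contra! hc
  have : Finset.univ.filter q ⊆ Finset.Ioi k := by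
    intro i hi
    rw [Finset.mem_Ioi]
    by_contra hk
    exact hc i (not_lt.1 hk) (Finset.mem_filter.1 hi).2
  have := Finset.card_le_card this
  rw [Fin.card_Ioi] at this
  have := k.2
  omega

/-- The map that reads the coordinates of a vector in the orthonormal basis `U` at the indices
that satisfy `q`. -/
def coordMap {n : ℕ} (U : Matrix (Fin n) (Fin n) ℝ) (q : Fin n → Prop) :
    (Fin n → ℝ) →ₗ[ℝ] {i // q i} → ℝ :=
  (LinearMap.funLeft ℝ ℝ Subtype.val) ∘ₗ Uᵀ.mulVecLin

theorem coordMap_eq_zero {n : ℕ} {U : Matrix (Fin n) (Fin n) ℝ} {q : Fin n → Prop}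
    {x : Fin n → ℝ} (h : coordMap U q x = 0) {i : Fin n} (hi : q i) : (Uᵀ *ᵥ x) i = 0 :=
  congrFun h ⟨i, hi⟩

/-! ### Perturbation of the leading eigenvalues of a Gram matrix -/

section Gram

variable {n d : ℕ} {X : Matrix (Fin n) (Fin d) ℝ} {U : Matrix (Fin n) (Fin n) ℝ} {p : Fin n → ℝ}

theorem dotProduct_gram_mulVec (X : Matrix (Fin n) (Fin d) ℝ) (x : Fin n → ℝ) :
    x ⬝ᵥ ((X * Xᵀ) *ᵥ x) = (Xᵀ *ᵥ x) ⬝ᵥ (Xᵀ *ᵥ x) := by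
  rw [← Matrix.mulVec_mulVec, Matrix.dotProduct_mulVec, ← Matrix.mulVec_transpose]

theorem transpose_mulVec_mulVec_of_orthogonal (hU : U ∈ Matrix.orthogonalGroup (Fin n) ℝ) (c : Fin n → ℝ) :
    Uᵀ *ᵥ (U *ᵥ c) = c := by
  have h1 : Uᵀ * U = 1 := (Matrix.mem_orthogonalGroup_iff' (Fin n) ℝ).1 hU
  rw [Matrix.mulVec_mulVec, h1, Matrix.one_mulVec]

theorem mulVec_transpose_mulVec_of_orthogonal (hU : U ∈ Matrix.orthogonalGroup (Fin n) ℝ)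
    (x : Fin n → ℝ) : U *ᵥ (Uᵀ *ᵥ x) = x := by
  have h1 : U * Uᵀ = 1 := (Matrix.mem_orthogonalGroup_iff (Fin n) ℝ).1 hU
  rw [Matrix.mulVec_mulVec, h1, Matrix.one_mulVec]

/-- The quadratic form of a spectral decomposition at the `i`-th eigenvector. -/
theorem quadratic_form_eigenvector (hU : U ∈ Matrix.orthogonalGroup (Fin n) ℝ) (ev : Fin n → ℝ)
    (i : Fin n) :
    (U *ᵥ Pi.single i 1) ⬝ᵥ ((U * Matrix.diagonal ev * Uᵀ) *ᵥ (U *ᵥ Pi.single i 1)) = ev i ∧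
      (U *ᵥ Pi.single i 1) ⬝ᵥ (U *ᵥ Pi.single i (1 : ℝ)) = 1 := by
  rw [dotProduct_mulVec_spectral, dotProduct_self_eq_sum_sq_transpose_mulVec hU,
    transpose_mulVec_mulVec_of_orthogonal hU]
  constructor <;> simp [Pi.single_apply]

theorem gram_eigenvalue_nonneg (hU : U ∈ Matrix.orthogonalGroup (Fin n) ℝ)
    (hP : X * Xᵀ = U * Matrix.diagonal p * Uᵀ) (i : Fin n) : 0 ≤ p i := by
  rw [← (quadratic_form_eigenvector hU p i).1, ← hP, dotProduct_gram_mulVec]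
  exact Finset.sum_nonneg fun j _ => mul_self_nonneg _

theorem le_gram_eigenvalue (hU : U ∈ Matrix.orthogonalGroup (Fin n) ℝ)
    (hP : X * Xᵀ = U * Matrix.diagonal p * Uᵀ) (hp : Antitone fun i => |p i|) {m : ℝ}
    (hm : 0 < m) (hX : ∀ w : Fin d → ℝ, m * (w ⬝ᵥ w) ≤ (X *ᵥ w) ⬝ᵥ (X *ᵥ w))
    {k : Fin n} (hk : (k : ℕ) < d) : m ≤ p k := by
  have hinj : Function.Injective X.mulVecLin := by
    rw [injective_iff_map_eq_zero]
    intro w hw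
    rw [Matrix.mulVecLin_apply] at hw
    have := hX w
    rw [hw, dotProduct_zero] at this
    apply eq_zero_of_dotProduct_self
    have h0 : 0 ≤ w ⬝ᵥ w := Finset.sum_nonneg fun j _ => mul_self_nonneg _
    nlinarith
  have hc := finrank_le_card_add_card_le_eigenvalue hU p m X.mulVecLin hinj
    (0 : (Fin d → ℝ) →ₗ[ℝ] Fin 0 → ℝ) (by
      intro w _
      rw [← hP, dotProduct_gram_mulVec, Matrix.mulVecLin_apply]
      set u := Xᵀ *ᵥ (X *ᵥ w) with hu
      have h1 : (X *ᵥ w) ⬝ᵥ (X *ᵥ w) = w ⬝ᵥ u := by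
        rw [hu, Matrix.dotProduct_mulVec w, ← Matrix.mulVec_transpose, Matrix.transpose_transpose]
      have h2 := hX w
      rw [h1] at h2 ⊢
      have h3 : 0 ≤ (u - m • w) ⬝ᵥ (u - m • w) :=
        Finset.sum_nonneg fun j _ => mul_self_nonneg _
      simp only [sub_dotProduct, dotProduct_sub, smul_dotProduct, dotProduct_smul,
        smul_eq_mul, dotProduct_comm u w] at h3
      nlinarith)
  rw [Module.finrank_fintype_fun_eq_card] at hc
  simp only [Fintype.card_fin, zero_add] at hc
  obtain ⟨i, hi, hmi⟩ := exists_ge_of_lt_card_filter _ k (hk.trans_le hc)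
  have := hp hi
  simp only at this
  rw [abs_of_nonneg (gram_eigenvalue_nonneg hU hP i),
    abs_of_nonneg (gram_eigenvalue_nonneg hU hP k)] at this
  linarith

theorem gram_eigenvalue_eq_zero (hU : U ∈ Matrix.orthogonalGroup (Fin n) ℝ)
    (hP : X * Xᵀ = U * Matrix.diagonal p * Uᵀ) (hp : Antitone fun i => |p i|)
    {k : Fin n} (hk : d ≤ k) : p k = 0 := by
  have hc := finrank_le_card_add_card_eigenvalue_le hU p 0 LinearMap.id Function.injective_id
    Xᵀ.mulVecLin (by
      intro x hx
      rw [Matrix.mulVecLin_apply] at hx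
      rw [← hP, LinearMap.id_apply, dotProduct_gram_mulVec, hx]
      simp)
  rw [Module.finrank_fintype_fun_eq_card] at hc
  simp only [Fintype.card_fin] at hc
  obtain ⟨i, hi, hmi⟩ := exists_le_of_le_add_card_filter (fun i => p i ≤ 0) k (by omega)
  have h0 : p i = 0 := le_antisymm hmi (gram_eigenvalue_nonneg hU hP i)
  have := hp hi
  simp only [h0, abs_zero] at this
  exact abs_eq_zero.1 (le_antisymm this (abs_nonneg _))

/-- A vector in the span of eigenvectors of `X Xᵀ` for nonzero eigenvalues is in the range of
`X`. -/
theorem exists_mulVec_eq_of_gram (hU : U ∈ Matrix.orthogonalGroup (Fin n) ℝ)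
    (hP : X * Xᵀ = U * Matrix.diagonal p * Uᵀ) {c : Fin n → ℝ}
    (hc : ∀ i, p i = 0 → c i = 0) : ∃ w, U *ᵥ c = X *ᵥ w := by
  refine ⟨Xᵀ *ᵥ (U *ᵥ fun i => c i / p i), ?_⟩
  rw [Matrix.mulVec_mulVec _ X, hP, ← Matrix.mulVec_mulVec, transpose_mulVec_mulVec_of_orthogonal hU,
    ← Matrix.mulVec_mulVec]
  congr 1
  ext i
  rw [Matrix.mulVec_diagonal]
  by_cases h : p i = 0
  · simp [h, hc i h]
  · field_simp

variable {A V : Matrix (Fin n) (Fin n) ℝ} {a : Fin n → ℝ} {m ε β : ℝ}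

/-- The quadratic form bound that controls the eigenvalues of a perturbed Gram matrix from
above. -/
theorem quadratic_form_le_of_gram_perturbation (hU : U ∈ Matrix.orthogonalGroup (Fin n) ℝ)
    (hP : X * Xᵀ = U * Matrix.diagonal p * Uᵀ) (hp : Antitone fun i => |p i|)
    (hm : 0 < m) (hpm : ∀ i : Fin n, (i : ℕ) < d → m ≤ p i) (hεm : ε ≤ m / 4)
    (hE : ∀ x y : Fin n → ℝ, |x ⬝ᵥ ((A - X * Xᵀ) *ᵥ y)| ≤ ε * √(x ⬝ᵥ x) * √(y ⬝ᵥ y))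
    (hβ : ∀ w : Fin d → ℝ, |(X *ᵥ w) ⬝ᵥ ((A - X * Xᵀ) *ᵥ (X *ᵥ w))| ≤
      β * ((X *ᵥ w) ⬝ᵥ (X *ᵥ w))) (hβ0 : 0 ≤ β)
    {k : Fin n} (hk : (k : ℕ) < d) {x : Fin n → ℝ} (hx : ∀ i < k, (Uᵀ *ᵥ x) i = 0) :
    x ⬝ᵥ (A *ᵥ x) ≤ (p k + (β + 2 * ε ^ 2 / m)) * (x ⬝ᵥ x) := by
  set c := Uᵀ *ᵥ x with hc
  set y := U *ᵥ (fun i => if (i : ℕ) < d then c i else 0) with hy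
  set z := U *ᵥ (fun i => if (i : ℕ) < d then 0 else c i) with hz
  have hxyz : x = y + z := by
    rw [hy, hz, ← Matrix.mulVec_add, ← mulVec_transpose_mulVec_of_orthogonal hU x, ← hc]
    congr 1
    ext i
    by_cases h : (i : ℕ) < d <;> simp [h]
  have hpn := gram_eigenvalue_nonneg hU hP
  obtain ⟨w, hw⟩ : ∃ w, y = X *ᵥ w := by
    apply exists_mulVec_eq_of_gram hU hP
    intro i hi
    have : ¬ (i : ℕ) < d := fun h => by linarith [hpm i h]
    simp [this]
  have hyy : y ⬝ᵥ y = ∑ i : Fin n, (if (i : ℕ) < d then c i else 0) ^ 2 := by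
    rw [dotProduct_self_eq_sum_sq_transpose_mulVec hU, hy, transpose_mulVec_mulVec_of_orthogonal hU]
  have hzz : z ⬝ᵥ z = ∑ i : Fin n, (if (i : ℕ) < d then 0 else c i) ^ 2 := by
    rw [dotProduct_self_eq_sum_sq_transpose_mulVec hU, hz, transpose_mulVec_mulVec_of_orthogonal hU]
  have hxx : x ⬝ᵥ x = y ⬝ᵥ y + z ⬝ᵥ z := by
    rw [dotProduct_self_eq_sum_sq_transpose_mulVec hU, hyy, hzz, ← Finset.sum_add_distrib]
    refine Finset.sum_congr rfl fun i _ => ?_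
    by_cases h : (i : ℕ) < d <;> simp [h, hc]
  have hPx : x ⬝ᵥ ((X * Xᵀ) *ᵥ x) ≤ p k * (y ⬝ᵥ y) := by
    rw [hP, dotProduct_mulVec_spectral, hyy, Finset.mul_sum, ← hc]
    refine Finset.sum_le_sum fun i _ => ?_
    by_cases h : (i : ℕ) < d
    · simp only [h, if_true]
      by_cases hik : i < k
      · simp [hx i hik]
      · have := hp (not_lt.1 hik)
        simp only [abs_of_nonneg (hpn _)] at this
        exact mul_le_mul_of_nonneg_right this (sq_nonneg _)
    · simp [gram_eigenvalue_eq_zero hU hP hp (not_lt.1 h), h]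
  have hEx : x ⬝ᵥ ((A - X * Xᵀ) *ᵥ x) ≤ β * (y ⬝ᵥ y) + 2 * ε * √(y ⬝ᵥ y) * √(z ⬝ᵥ z)
      + ε * (z ⬝ᵥ z) := by
    have e1 := le_of_abs_le (hβ w)
    rw [← hw] at e1
    have e2 := le_of_abs_le (hE y z)
    have e3 := le_of_abs_le (hE z y)
    have e4 := le_of_abs_le (hE z z)
    rw [mul_assoc, Real.mul_self_sqrt (by rw [hzz]; positivity)] at e4
    rw [hxyz]
    clear_value y z
    simp only [Matrix.mulVec_add, add_dotProduct, dotProduct_add]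
    linarith
  have hsplit : x ⬝ᵥ (A *ᵥ x) = x ⬝ᵥ ((X * Xᵀ) *ᵥ x) + x ⬝ᵥ ((A - X * Xᵀ) *ᵥ x) := by
    rw [Matrix.sub_mulVec, dotProduct_sub]
    ring
  rw [hsplit, hxx]
  have hpk := hpm k hk
  have hy0 : 0 ≤ y ⬝ᵥ y := by rw [hyy]; positivity
  have hz0 : 0 ≤ z ⬝ᵥ z := by rw [hzz]; positivity
  obtain ⟨s, hs0, hs⟩ : ∃ s : ℝ, 0 ≤ s ∧ s = √(y ⬝ᵥ y) := ⟨_, Real.sqrt_nonneg _, rfl⟩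
  obtain ⟨t, ht0, ht⟩ : ∃ t : ℝ, 0 ≤ t ∧ t = √(z ⬝ᵥ z) := ⟨_, Real.sqrt_nonneg _, rfl⟩
  have hs2 : s ^ 2 = y ⬝ᵥ y := by rw [hs, Real.sq_sqrt hy0]
  have ht2 : t ^ 2 = z ⬝ᵥ z := by rw [ht, Real.sq_sqrt hz0]
  rw [← hs, ← ht, ← hs2, ← ht2] at hEx
  rw [← hs2] at hPx
  rw [← hs2, ← ht2]
  have hq : 2 * ε * s * t ≤ 2 * ε ^ 2 / m * s ^ 2 + m / 2 * t ^ 2 := by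
    have : 0 ≤ 2 / m * (ε * s - m / 2 * t) ^ 2 := by positivity
    have e : 2 / m * (ε * s - m / 2 * t) ^ 2 =
        2 * ε ^ 2 / m * s ^ 2 + m / 2 * t ^ 2 - 2 * ε * s * t := by
      field_simp
      ring
    linarith
  have h5 : (ε + m / 2) * t ^ 2 ≤ p k * t ^ 2 :=
    mul_le_mul_of_nonneg_right (by linarith) (sq_nonneg _)
  have h6 : 0 ≤ (β + 2 * ε ^ 2 / m) * t ^ 2 := by positivity
  nlinarith

/-- If `A` is a small perturbation of `X Xᵀ`, where `Xᵀ X ≥ m`, then its `d` leading eigenvalues in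
magnitude differ from those of `X Xᵀ` by at most the size of the perturbation on the range of `X`
plus a second order term. -/
theorem abs_leading_eigenvalue_sub_le
    (hU : U ∈ Matrix.orthogonalGroup (Fin n) ℝ)
    (hP : X * Xᵀ = U * Matrix.diagonal p * Uᵀ) (hp : Antitone fun i => |p i|)
    (hV : V ∈ Matrix.orthogonalGroup (Fin n) ℝ)
    (hA : A = V * Matrix.diagonal a * Vᵀ) (ha : Antitone fun i => |a i|)
    (hm : 0 < m) (hX : ∀ w : Fin d → ℝ, m * (w ⬝ᵥ w) ≤ (X *ᵥ w) ⬝ᵥ (X *ᵥ w))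
    (hεm : ε ≤ m / 4)
    (hE : ∀ x y : Fin n → ℝ, |x ⬝ᵥ ((A - X * Xᵀ) *ᵥ y)| ≤ ε * √(x ⬝ᵥ x) * √(y ⬝ᵥ y))
    (hβ : ∀ w : Fin d → ℝ, |(X *ᵥ w) ⬝ᵥ ((A - X * Xᵀ) *ᵥ (X *ᵥ w))| ≤
      β * ((X *ᵥ w) ⬝ᵥ (X *ᵥ w))) (hβ0 : 0 ≤ β) (hβm : β ≤ m / 4)
    {k : Fin n} (hk : (k : ℕ) < d) : |a k - p k| ≤ β + 2 * ε ^ 2 / m := by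
  have hpn := gram_eigenvalue_nonneg hU hP
  have hpm : ∀ i : Fin n, (i : ℕ) < d → m ≤ p i := fun i hi =>
    le_gram_eigenvalue hU hP hp hm hX hi
  have han : ∀ i, -ε ≤ a i := by
    intro i
    obtain ⟨h1, h2⟩ := quadratic_form_eigenvector hV a i
    rw [← hA] at h1
    set v := V *ᵥ Pi.single i (1 : ℝ)
    have h3 := neg_le_of_abs_le (hE v v)
    rw [h2, Matrix.sub_mulVec, dotProduct_sub, h1, dotProduct_gram_mulVec] at h3
    have h4 : 0 ≤ (Xᵀ *ᵥ v) ⬝ᵥ (Xᵀ *ᵥ v) := Finset.sum_nonneg fun j _ => mul_self_nonneg _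
    simp at h3
    linarith
  have hlow : ∀ j : Fin n, (j : ℕ) < d → p j - β ≤ |a j| ∧ |a j| = a j := by
    intro j hj
    have hc := finrank_le_card_add_card_le_eigenvalue hV a (p j - β) LinearMap.id
      Function.injective_id (coordMap U fun i => j < i) (by
        intro x hx
        rw [LinearMap.id_apply, ← hA]
        have hz : ∀ i, j < i → (Uᵀ *ᵥ x) i = 0 := fun i hi => coordMap_eq_zero hx hi
        obtain ⟨w, hw⟩ : ∃ w, U *ᵥ (Uᵀ *ᵥ x) = X *ᵥ w := by
          apply exists_mulVec_eq_of_gram hU hP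
          intro i hi
          apply hz
          by_contra hij
          have : (i : ℕ) ≤ j := not_lt.1 hij
          linarith [hpm i (this.trans_lt hj)]
        rw [mulVec_transpose_mulVec_of_orthogonal hU] at hw
        have e1 := neg_le_of_abs_le (hβ w)
        rw [← hw, Matrix.sub_mulVec, dotProduct_sub, hP, dotProduct_mulVec_spectral] at e1
        have e2 : p j * (x ⬝ᵥ x) ≤ ∑ i, p i * ((Uᵀ *ᵥ x) i) ^ 2 := by
          rw [dotProduct_self_eq_sum_sq_transpose_mulVec hU, Finset.mul_sum]
          refine Finset.sum_le_sum fun i _ => ?_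
          by_cases hij : j < i
          · simp [hz i hij]
          · have := hp (not_lt.1 hij)
            simp only [abs_of_nonneg (hpn _)] at this
            exact mul_le_mul_of_nonneg_right this (sq_nonneg _)
        linarith)
    rw [Module.finrank_fintype_fun_eq_card, Fintype.card_subtype,
      Finset.filter_lt_eq_Ioi, Fin.card_Ioi] at hc
    simp only [Fintype.card_fin] at hc
    obtain ⟨i, hi, hai⟩ := exists_ge_of_lt_card_filter (fun i => p j - β ≤ a i) j (by have := j.2; omega)
    have h1 : |a i| ≤ |a j| := ha hi
    have h2 : p j - β ≤ |a j| := hai.trans ((le_abs_self _).trans h1)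
    refine ⟨h2, ?_⟩
    rcases abs_cases (a j) with ⟨h, _⟩ | ⟨h, _⟩
    · exact h
    · have := han j
      have := hpm j hj
      exfalso
      linarith
  have hup : a k ≤ p k + (β + 2 * ε ^ 2 / m) := by
    have hc := finrank_le_card_add_card_eigenvalue_le hV a (p k + (β + 2 * ε ^ 2 / m))
      LinearMap.id Function.injective_id (coordMap U fun i => i < k) (by
        intro x hx
        rw [LinearMap.id_apply, ← hA]
        exact quadratic_form_le_of_gram_perturbation hU hP hp hm hpm hεm hE hβ hβ0 hk
          fun i hi => coordMap_eq_zero hx hi)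
    rw [Module.finrank_fintype_fun_eq_card, Fintype.card_subtype,
      Finset.filter_gt_eq_Iio, Fin.card_Iio] at hc
    simp only [Fintype.card_fin] at hc
    obtain ⟨i, hi, hai⟩ := exists_le_of_le_add_card_filter _ k hc
    have hid : (i : ℕ) < d := lt_of_le_of_lt hi hk
    have h1 : |a k| ≤ |a i| := ha hi
    rw [(hlow i hid).2, (hlow k hk).2] at h1
    exact h1.trans hai
  have h1 := hlow k hk
  rw [h1.2] at h1
  have h2 : 0 ≤ 2 * ε ^ 2 / m := by positivity
  rw [abs_le]
  constructor <;> linarith [h1.1]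

end Gram

/-! ### Frobenius norms -/

theorem frobenius_norm_diagonal_sq {d : ℕ} (v : Fin d → ℝ) :
    ‖Matrix.diagonal v‖ ^ 2 = ∑ k, v k ^ 2 := by
  rw [Matrix.frobenius_norm_diagonal, EuclideanSpace.norm_sq_eq]
  simp

/-- The leading eigenvalues of a matrix are bounded in Frobenius norm by its entries. -/
theorem IsTopEigenvalueMatrix.norm_le {n d : ℕ} {hdn : d ≤ n} {M : Matrix (Fin n) (Fin n) ℝ}
    {S : Matrix (Fin d) (Fin d) ℝ} (h : IsTopEigenvalueMatrix hdn M S)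
    (hM : ∀ i j, |M i j| ≤ 1) : ‖S‖ ≤ n := by
  obtain ⟨U, hU, ev, rfl, -, rfl⟩ := h
  have h1 : Uᵀ * U = 1 := (Matrix.mem_orthogonalGroup_iff' (Fin n) ℝ).1 hU
  set M := U * Matrix.diagonal ev * Uᵀ with hMdef
  have htr : ∑ i, ∑ j, M i j ^ 2 = ∑ i, ev i ^ 2 := by
    have e1 : (M * Mᵀ).trace = ∑ i, ∑ j, M i j ^ 2 := by
      simp [Matrix.trace, Matrix.mul_apply, sq]
    have e2 : M * Mᵀ = U * (Matrix.diagonal ev * Matrix.diagonal ev * Uᵀ) := by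
      rw [hMdef]
      simp only [Matrix.transpose_mul, Matrix.transpose_transpose, Matrix.diagonal_transpose]
      calc U * Matrix.diagonal ev * Uᵀ * (U * (Matrix.diagonal ev * Uᵀ))
          = U * Matrix.diagonal ev * (Uᵀ * U) * (Matrix.diagonal ev * Uᵀ) := by
            simp only [Matrix.mul_assoc]
        _ = _ := by rw [h1, Matrix.mul_one]; simp only [Matrix.mul_assoc]
    rw [← e1, e2, Matrix.trace_mul_comm, Matrix.mul_assoc, h1, Matrix.mul_one]
    simp [Matrix.diagonal_mul_diagonal, Matrix.trace, sq]
  have h2 : ‖Matrix.diagonal fun k : Fin d => ev (Fin.castLE hdn k)‖ ^ 2 ≤ (n : ℝ) ^ 2 := by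
    rw [frobenius_norm_diagonal_sq]
    calc ∑ k : Fin d, ev (Fin.castLE hdn k) ^ 2
        = ∑ i ∈ Finset.univ.map (Fin.castLEEmb hdn), ev i ^ 2 := by
          rw [Finset.sum_map]; rfl
      _ ≤ ∑ i, ev i ^ 2 :=
          Finset.sum_le_sum_of_subset_of_nonneg (Finset.subset_univ _) fun i _ _ => sq_nonneg _
      _ = ∑ i, ∑ j, M i j ^ 2 := htr.symm
      _ ≤ ∑ i : Fin n, ∑ j : Fin n, 1 := by
          gcongr with i _ j _
          exact (sq_le_one_iff_abs_le_one _).2 (hM i j)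
      _ = (n : ℝ) ^ 2 := by simp [sq]
  exact (sq_le_sq₀ (norm_nonneg _) (Nat.cast_nonneg _)).1 h2

theorem frobenius_norm_diagonal_le {d : ℕ} {v : Fin d → ℝ} {b : ℝ} (hb : 0 ≤ b)
    (hv : ∀ k, |v k| ≤ b) : ‖Matrix.diagonal v‖ ≤ d * b := by
  refine (sq_le_sq₀ (norm_nonneg _) (by positivity)).1 ?_
  rw [frobenius_norm_diagonal_sq]
  calc ∑ k, v k ^ 2 ≤ ∑ _k : Fin d, b ^ 2 :=
        Finset.sum_le_sum fun k _ => sq_le_sq' (by linarith [neg_le_of_abs_le (hv k)])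
          (le_of_abs_le (hv k))
    _ = d * b ^ 2 := by simp
    _ ≤ (d * b) ^ 2 := by
        have : (d : ℝ) ≤ d ^ 2 := by exact_mod_cast Nat.le_self_pow two_ne_zero d
        nlinarith [sq_nonneg b]

/-! ### Nets of the unit ball -/

theorem exists_finset_net (E : Type*) [NormedAddCommGroup E] [NormedSpace ℝ E]
    [FiniteDimensional ℝ E] :
    ∃ N : Finset E, N.card ≤ 5 ^ Module.finrank ℝ E ∧ (∀ u ∈ N, ‖u‖ ≤ 1) ∧
      ∀ x : E, ‖x‖ ≤ 1 → ∃ u ∈ N, ‖x - u‖ ≤ 1 / 2 := by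
  classical
  let Q : Finset E → Prop := fun s =>
    (∀ c ∈ s, ‖c‖ ≤ 2) ∧ ∀ c ∈ s, ∀ e ∈ s, c ≠ e → 1 ≤ ‖c - e‖
  have hcard : ∀ s, Q s → s.card ≤ 5 ^ Module.finrank ℝ E := fun s hs =>
    Besicovitch.card_le_of_separated s hs.1 hs.2
  let K : Set ℕ := {k | ∃ s, Q s ∧ s.card = k}
  have hK : BddAbove K := ⟨5 ^ Module.finrank ℝ E, by rintro _ ⟨s, hs, rfl⟩; exact hcard s hs⟩
  have hK0 : K.Nonempty := ⟨0, ∅, ⟨by simp, by simp⟩, by simp⟩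
  obtain ⟨s, hs, hmax⟩ := Nat.sSup_mem hK0 hK
  have hnet : ∀ x : E, ‖x‖ ≤ 2 → ∃ c ∈ s, ‖x - c‖ < 1 := by
    intro x hx
    by_contra! hc
    have hxs : x ∉ s := fun h => by have := hc x h; simp at this; linarith
    have hQ : Q (insert x s) := by
      refine ⟨fun c hc' => ?_, fun c hc' e he hne => ?_⟩
      · rcases Finset.mem_insert.1 hc' with rfl | h
        · exact hx
        · exact hs.1 c h
      · rcases Finset.mem_insert.1 hc' with rfl | h <;>
          rcases Finset.mem_insert.1 he with rfl | h'
        · exact absurd rfl hne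
        · exact hc e h'
        · rw [norm_sub_rev]; exact hc c h
        · exact hs.2 c h e h' hne
    have := le_csSup hK ⟨_, hQ, Finset.card_insert_of_notMem hxs⟩
    omega
  refine ⟨s.image fun c => (1 / 2 : ℝ) • c, Finset.card_image_le.trans (hcard s hs), ?_, ?_⟩
  · intro u hu
    obtain ⟨c, hc, rfl⟩ := Finset.mem_image.1 hu
    have := hs.1 c hc
    rw [norm_smul]
    norm_num
    linarith
  · intro x hx
    obtain ⟨c, hc, hxc⟩ := hnet ((2 : ℝ) • x) (by rw [norm_smul]; norm_num; linarith)
    refine ⟨_, Finset.mem_image_of_mem _ hc, ?_⟩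
    have : x - (1 / 2 : ℝ) • c = (1 / 2 : ℝ) • ((2 : ℝ) • x - c) := by
      rw [smul_sub, smul_smul]
      norm_num
    rw [this, norm_smul]
    norm_num
    linarith

theorem norm_toLp_eq_sqrt_dotProduct {p : ℕ} (x : Fin p → ℝ) :
    ‖WithLp.toLp 2 x‖ = √(x ⬝ᵥ x) := by
  rw [EuclideanSpace.norm_eq]
  simp [dotProduct, sq]

theorem inner_toLp_eq_dotProduct {p : ℕ} (x y : Fin p → ℝ) :
    inner ℝ (WithLp.toLp 2 x) (WithLp.toLp 2 y) = x ⬝ᵥ y := by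
  rw [EuclideanSpace.inner_toLp_toLp, dotProduct_comm]
  simp

theorem abs_dotProduct_le {p : ℕ} (x y : Fin p → ℝ) :
    |x ⬝ᵥ y| ≤ √(x ⬝ᵥ x) * √(y ⬝ᵥ y) := by
  rw [← inner_toLp_eq_dotProduct x y, ← norm_toLp_eq_sqrt_dotProduct,
    ← norm_toLp_eq_sqrt_dotProduct]
  exact abs_real_inner_le_norm _ _

/-- There is a finite set of vectors in the unit ball that determines the norm of every vector up
to a factor `2`. -/
theorem exists_finset_norming (p : ℕ) :
    ∃ N : Finset (Fin p → ℝ), N.card ≤ 5 ^ p ∧ (∀ u ∈ N, u ⬝ᵥ u ≤ 1) ∧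
      ∀ (b : Fin p → ℝ) (τ : ℝ), (∀ u ∈ N, |u ⬝ᵥ b| ≤ τ) → √(b ⬝ᵥ b) ≤ 2 * τ := by
  classical
  obtain ⟨N, hcard, hN1, hN⟩ := exists_finset_net (EuclideanSpace ℝ (Fin p))
  refine ⟨N.image WithLp.ofLp, ?_, ?_, ?_⟩
  · simpa using Finset.card_image_le.trans hcard
  · intro u hu
    obtain ⟨v, hv, rfl⟩ := Finset.mem_image.1 hu
    have := hN1 v hv
    rw [← WithLp.toLp_ofLp 2 v, norm_toLp_eq_sqrt_dotProduct, Real.sqrt_le_iff] at this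
    simpa using this.2
  · intro b τ hb
    set b' : EuclideanSpace ℝ (Fin p) := WithLp.toLp 2 b with hb'
    have key : ∀ u ∈ N, |inner ℝ u b'| ≤ τ := by
      intro u hu
      have := hb _ (Finset.mem_image_of_mem _ hu)
      rwa [← inner_toLp_eq_dotProduct] at this
    rw [← norm_toLp_eq_sqrt_dotProduct, ← hb']
    have hx1 : ‖(‖b'‖⁻¹ : ℝ) • b'‖ ≤ 1 := by
      rw [norm_smul, norm_inv, norm_norm]
      exact inv_mul_le_one
    obtain ⟨u, hu, hxu⟩ := hN _ hx1
    have e1 : inner ℝ ((‖b'‖⁻¹ : ℝ) • b') b' = ‖b'‖ := by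
      rw [real_inner_smul_left, real_inner_self_eq_norm_sq]
      by_cases h : ‖b'‖ = 0
      · simp [h]
      · field_simp
    have e2 : inner ℝ ((‖b'‖⁻¹ : ℝ) • b') b' =
        inner ℝ u b' + inner ℝ ((‖b'‖⁻¹ : ℝ) • b' - u) b' := by
      rw [inner_sub_left]; ring
    have e3 := le_of_abs_le (key u hu)
    have e4 := (real_inner_le_norm ((‖b'‖⁻¹ : ℝ) • b' - u) b').trans
      (mul_le_mul_of_nonneg_right hxu (norm_nonneg _))
    linarith

/-- A bilinear form that is small on a norming set is small. -/
theorem abs_dotProduct_mulVec_le_of_norming {p : ℕ} {N : Finset (Fin p → ℝ)}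
    (hN : ∀ (b : Fin p → ℝ) (τ : ℝ), (∀ u ∈ N, |u ⬝ᵥ b| ≤ τ) → √(b ⬝ᵥ b) ≤ 2 * τ)
    {M : Matrix (Fin p) (Fin p) ℝ} {τ : ℝ} (hM : ∀ u ∈ N, ∀ v ∈ N, |u ⬝ᵥ (M *ᵥ v)| ≤ τ)
    (x y : Fin p → ℝ) : |x ⬝ᵥ (M *ᵥ y)| ≤ 4 * τ * √(x ⬝ᵥ x) * √(y ⬝ᵥ y) := by
  have h1 : ∀ v ∈ N, √((M *ᵥ v) ⬝ᵥ (M *ᵥ v)) ≤ 2 * τ := fun v hv =>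
    hN _ _ fun u hu => hM u hu v hv
  have h2 : √((Mᵀ *ᵥ x) ⬝ᵥ (Mᵀ *ᵥ x)) ≤ 2 * (√(x ⬝ᵥ x) * (2 * τ)) := by
    refine hN _ _ fun v hv => ?_
    rw [dotProduct_comm, Matrix.mulVec_transpose, ← Matrix.dotProduct_mulVec]
    exact (abs_dotProduct_le _ _).trans
      (mul_le_mul_of_nonneg_left (h1 v hv) (Real.sqrt_nonneg _))
  rw [Matrix.dotProduct_mulVec, ← Matrix.mulVec_transpose]
  calc |(Mᵀ *ᵥ x) ⬝ᵥ y| ≤ √((Mᵀ *ᵥ x) ⬝ᵥ (Mᵀ *ᵥ x)) * √(y ⬝ᵥ y) := abs_dotProduct_le _ _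
    _ ≤ 2 * (√(x ⬝ᵥ x) * (2 * τ)) * √(y ⬝ᵥ y) :=
        mul_le_mul_of_nonneg_right h2 (Real.sqrt_nonneg _)
    _ = _ := by ring

/-! ### Hoeffding's inequality for the edges, conditionally on the latent positions -/

/-- Hoeffding's lemma for a centered Bernoulli variable. -/
theorem bernoulli_mgf_le {p : ℝ} (hp : p ∈ Set.Icc (0 : ℝ) 1) (c : ℝ) :
    p * Real.exp (c * (1 - p)) + (1 - p) * Real.exp (c * (0 - p)) ≤ Real.exp (c ^ 2 / 8) := by
  let ν : Measure ℝ := ENNReal.ofReal p • Measure.dirac 1 + ENNReal.ofReal (1 - p) • Measure.dirac 0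
  have hν : IsProbabilityMeasure ν := ⟨by
    simp only [ν, Measure.add_apply, Measure.smul_apply, measure_univ, smul_eq_mul, mul_one]
    rw [← ENNReal.ofReal_add hp.1 (by linarith [hp.2])]
    simp⟩
  have hint : ∀ g : ℝ → ℝ, ∫ x, g x ∂ν = p * g 1 + (1 - p) * g 0 := by
    intro g
    have hi : ∀ a : ℝ, ∀ r : ℝ, Integrable g (ENNReal.ofReal r • Measure.dirac a) := fun a r =>
      (integrable_dirac (by simp)).smul_measure ENNReal.ofReal_ne_top
    simp only [ν]
    rw [integral_add_measure (hi _ _) (hi _ _), integral_smul_measure, integral_smul_measure,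
      integral_dirac, integral_dirac, ENNReal.toReal_ofReal hp.1,
      ENNReal.toReal_ofReal (by linarith [hp.2])]
    rfl
  have h := (hasSubgaussianMGF_of_mem_Icc (μ := ν) (X := id) (a := 0) (b := 1)
    aemeasurable_id (by
      simp only [ν, id, ae_add_measure_iff]
      constructor <;> refine Measure.ae_smul_measure ?_ _ <;>
        simp)).mgf_le c
  rw [mgf, hint] at h
  have hm : ∫ x, id x ∂ν = p := by rw [hint]; simp
  simp only [hm] at h
  refine h.trans_eq ?_
  norm_num
  ring

/-- The pairs of indices above the diagonal. -/
abbrev UpperPair (n : ℕ) := {q : Fin n × Fin n // q.1 < q.2}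

@[to_additive]
theorem prod_upperPair {n : ℕ} {M : Type*} [CommMonoid M] (f : Fin n → Fin n → M) :
    ∏ i, ∏ j ∈ Finset.Ioi i, f i j = ∏ q : UpperPair n, f q.1.1 q.1.2 := by
  rw [Finset.prod_sigma']
  refine Finset.prod_bij' (fun x hx => ⟨(x.1, x.2), by simpa using hx⟩)
    (fun q _ => ⟨q.1.1, q.1.2⟩) ?_ ?_ ?_ ?_ ?_
  all_goals simp

/-- The real number `0` or `1` coded by a Boolean. -/
noncomputable def boolVal (b : Bool) : ℝ := if b then 1 else 0

theorem sum_bernoulliWeight_mul_exp_le {ι : Type*} [Fintype ι] [DecidableEq ι] (p c : ι → ℝ)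
    (hp : ∀ q, p q ∈ Set.Icc (0 : ℝ) 1) :
    ∑ σ : ι → Bool, (∏ q, bernoulliWeight (p q) (boolVal (σ q))) *
      Real.exp (∑ q, c q * (boolVal (σ q) - p q) - (∑ q, c q ^ 2) / 8) ≤ 1 := by
  have h1 : ∀ σ : ι → Bool, (∏ q, bernoulliWeight (p q) (boolVal (σ q))) *
      Real.exp (∑ q, c q * (boolVal (σ q) - p q) - (∑ q, c q ^ 2) / 8) =
      ∏ q, bernoulliWeight (p q) (boolVal (σ q)) *
        Real.exp (c q * (boolVal (σ q) - p q) - c q ^ 2 / 8) := by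
    intro σ
    rw [Finset.prod_mul_distrib, ← Real.exp_sum, Finset.sum_sub_distrib, Finset.sum_div]
  simp_rw [h1]
  have h2 := (Finset.prod_univ_sum (fun _ : ι => (Finset.univ : Finset Bool))
    (fun q b => bernoulliWeight (p q) (boolVal b) *
        Real.exp (c q * (boolVal b - p q) - c q ^ 2 / 8))).symm
  rw [Fintype.piFinset_univ] at h2
  rw [h2]
  refine Finset.prod_le_one (fun q _ => ?_) (fun q _ => ?_)
  · refine Finset.sum_nonneg fun b _ => mul_nonneg ?_ (Real.exp_pos _).le
    have := hp q
    unfold bernoulliWeight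
    split_ifs
    · exact this.1
    · linarith [this.2]
  · have := bernoulli_mgf_le (hp q) (c q)
    simp only [Fintype.sum_bool, boolVal, bernoulliWeight, Real.exp_sub]
    simp only [if_true, Bool.false_eq_true, if_false, zero_ne_one]
    rw [← mul_div_assoc, ← mul_div_assoc, ← add_div, div_le_one (Real.exp_pos _)]
    exact this

section RDPG

variable {Ω : Type*} [MeasurableSpace Ω] {μ : Measure Ω} {n d : ℕ}
  {F : Measure (EuclideanSpace ℝ (Fin d))} {X : Fin n → Ω → EuclideanSpace ℝ (Fin d)}
  {A : Ω → Matrix (Fin n) (Fin n) ℝ}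

/-- The event that the pattern of edges is `σ`. -/
def patternEvent (A : Ω → Matrix (Fin n) (Fin n) ℝ) (σ : UpperPair n → Bool) : Set Ω :=
  {ω | ∀ q : UpperPair n, A ω q.1.1 q.1.2 = boolVal (σ q)}

/-- The conditional probability of the pattern `σ` given the latent positions. -/
noncomputable def patternWeight (σ : UpperPair n → Bool) (x : Fin n → EuclideanSpace ℝ (Fin d)) : ℝ :=
  ∏ q : UpperPair n, bernoulliWeight (inner ℝ (x q.1.1) (x q.1.2)) (boolVal (σ q))

theorem measurable_patternWeight (σ : UpperPair n → Bool) :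
    Measurable (patternWeight (d := d) σ) := by
  unfold patternWeight bernoulliWeight
  refine Finset.measurable_prod _ fun q _ => ?_
  split_ifs
  · exact (measurable_pi_apply _).inner (measurable_pi_apply _)
  · exact measurable_const.sub ((measurable_pi_apply _).inner (measurable_pi_apply _))

theorem patternWeight_nonneg (σ : UpperPair n → Bool) {x : Fin n → EuclideanSpace ℝ (Fin d)}
    (hx : ∀ i j, inner ℝ (x i) (x j) ∈ Set.Icc (0 : ℝ) 1) : 0 ≤ patternWeight σ x := by
  refine Finset.prod_nonneg fun q _ => ?_
  have := hx q.1.1 q.1.2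
  unfold bernoulliWeight
  split_ifs
  · exact this.1
  · linarith [this.2]

theorem IsRDPG.measurable_positions (h : IsRDPG μ F X A) : Measurable fun ω i => X i ω :=
  measurable_pi_lambda _ h.measurable_latent

theorem IsRDPG.measurableSet_patternEvent (h : IsRDPG μ F X A) (σ : UpperPair n → Bool) :
    MeasurableSet (patternEvent A σ) := by
  unfold patternEvent
  rw [Set.ofPred_forall]
  exact MeasurableSet.iInter fun q => h.measurable_adj _ _ (measurableSet_singleton _)

theorem IsRDPG.condExp_patternEvent (h : IsRDPG μ F X A) (σ : UpperPair n → Bool) :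
    μ⟦patternEvent A σ | MeasurableSpace.comap (fun ω i => X i ω) inferInstance⟧
      =ᵐ[μ] fun ω => patternWeight σ fun i => X i ω := by
  have h1 := h.adj_cond (fun i j => if hij : i < j then boolVal (σ ⟨(i, j), hij⟩) else 0) (by
    intro i j
    split_ifs
    · unfold boolVal; split_ifs <;> simp
    · simp)
  have h2 : {ω | ∀ i j, i < j → A ω i j =
      if hij : i < j then boolVal (σ ⟨(i, j), hij⟩) else 0} = patternEvent A σ := by
    ext ω
    constructor
    · intro hω q
      have := hω q.1.1 q.1.2 q.2
      rwa [dif_pos q.2] at this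
    · intro hω i j hij
      rw [dif_pos hij]
      exact hω ⟨(i, j), hij⟩
  rw [h2] at h1
  refine h1.trans (Filter.Eventually.of_forall fun ω => ?_)
  simp only
  rw [prod_upperPair fun i j => bernoulliWeight (inner ℝ (X i ω) (X j ω))
    (if hij : i < j then boolVal (σ ⟨(i, j), hij⟩) else 0)]
  refine Finset.prod_congr rfl fun q _ => ?_
  rw [dif_pos q.2]

theorem IsRDPG.lintegral_patternEvent [IsProbabilityMeasure μ] (h : IsRDPG μ F X A)
    (hX : ∀ᵐ ω ∂μ, ∀ i j, inner ℝ (X i ω) (X j ω) ∈ Set.Icc (0 : ℝ) 1)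
    (σ : UpperPair n → Bool) {g : (Fin n → EuclideanSpace ℝ (Fin d)) → ENNReal}
    (hg : Measurable g) :
    ∫⁻ ω in patternEvent A σ, g (fun i => X i ω) ∂μ =
      ∫⁻ ω, ENNReal.ofReal (patternWeight σ fun i => X i ω) * g (fun i => X i ω) ∂μ := by
  have hXm := h.measurable_positions
  have hs := h.measurableSet_patternEvent σ
  have hw : Measurable fun ω => ENNReal.ofReal (patternWeight σ fun i => X i ω) :=
    ENNReal.measurable_ofReal.comp ((measurable_patternWeight σ).comp hXm)
  have hce := h.condExp_patternEvent σ
  have heq : (μ.restrict (patternEvent A σ)).map (fun ω i => X i ω) =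
      (μ.withDensity fun ω => ENNReal.ofReal (patternWeight σ fun i => X i ω)).map
        (fun ω i => X i ω) := by
    ext B hB
    have hpre := hXm hB
    rw [Measure.map_apply hXm hB, Measure.map_apply hXm hB, Measure.restrict_apply hpre,
      withDensity_apply _ hpre]
    have hi : Integrable (fun ω => patternWeight σ fun i => X i ω) μ :=
      integrable_condExp.congr hce
    have h1 := setIntegral_condExp (μ := μ) (f := (patternEvent A σ).indicator fun _ => (1 : ℝ))
      hXm.comap_le ((integrable_const (1 : ℝ)).indicator hs)
      (s := (fun ω i => X i ω) ⁻¹' B) ⟨B, hB, rfl⟩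
    rw [setIntegral_congr_ae hpre (hce.mono fun ω hω _ => hω), setIntegral_indicator hs,
      setIntegral_const, smul_eq_mul, mul_one] at h1
    rw [← ofReal_integral_eq_lintegral_ofReal hi.integrableOn
      (ae_restrict_of_ae (hX.mono fun ω hω => patternWeight_nonneg σ hω)), h1, ofReal_measureReal]
  rw [← lintegral_map hg hXm, heq, lintegral_map hg hXm]
  exact lintegral_withDensity_eq_lintegral_mul _ hw (hg.comp hXm)

/-- The exponential moment bound behind Hoeffding's inequality, with coefficients that depend on
the latent positions. -/
theorem IsRDPG.lintegral_exp_le_one [IsProbabilityMeasure μ] (h : IsRDPG μ F X A)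
    (hX : ∀ᵐ ω ∂μ, ∀ i j, inner ℝ (X i ω) (X j ω) ∈ Set.Icc (0 : ℝ) 1)
    {c : (Fin n → EuclideanSpace ℝ (Fin d)) → UpperPair n → ℝ} (hc : ∀ q, Measurable (c · q)) :
    ∫⁻ ω, ENNReal.ofReal (Real.exp (∑ q : UpperPair n, c (fun i => X i ω) q *
      (A ω q.1.1 q.1.2 - inner ℝ (X q.1.1 ω) (X q.1.2 ω)) -
        (∑ q, c (fun i => X i ω) q ^ 2) / 8)) ∂μ ≤ 1 := by
  have hXm := h.measurable_positions
  let e : (UpperPair n → Bool) → (Fin n → EuclideanSpace ℝ (Fin d)) → ℝ := fun σ x =>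
    Real.exp (∑ q : UpperPair n, c x q * (boolVal (σ q) - inner ℝ (x q.1.1) (x q.1.2)) -
      (∑ q, c x q ^ 2) / 8)
  have he : ∀ σ, Measurable fun x => ENNReal.ofReal (e σ x) := by
    intro σ
    refine ENNReal.measurable_ofReal.comp (Real.measurable_exp.comp ?_)
    refine Measurable.sub (Finset.measurable_sum _ fun q _ => ?_)
      (Measurable.div_const (Finset.measurable_sum _ fun q _ => (hc q).pow_const 2) _)
    exact (hc q).mul (measurable_const.sub
      ((measurable_pi_apply _).inner (measurable_pi_apply _)))
  calc _ ≤ ∫⁻ ω, ∑ σ : UpperPair n → Bool, (patternEvent A σ).indicator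
        (fun ω => ENNReal.ofReal (e σ fun i => X i ω)) ω ∂μ := by
        refine lintegral_mono fun ω => ?_
        let σ : UpperPair n → Bool := fun q => decide (A ω q.1.1 q.1.2 = 1)
        have hσ : ∀ q : UpperPair n, A ω q.1.1 q.1.2 = boolVal (σ q) := by
          intro q
          rcases h.adj_zero_or_one ω q.1.1 q.1.2 with h0 | h0 <;> simp [σ, boolVal, h0]
        refine le_trans (le_of_eq ?_) (Finset.single_le_sum (fun _ _ => zero_le)
          (Finset.mem_univ σ))
        rw [Set.indicator_of_mem (show ω ∈ patternEvent A σ from hσ)]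
        simp only [e, hσ]
    _ = ∑ σ : UpperPair n → Bool, ∫⁻ ω, ENNReal.ofReal (patternWeight σ fun i => X i ω) *
        ENNReal.ofReal (e σ fun i => X i ω) ∂μ := by
        rw [lintegral_finsetSum _ fun σ _ => Measurable.indicator
          (show Measurable fun ω => ENNReal.ofReal (e σ fun i => X i ω) from (he σ).comp hXm)
          (h.measurableSet_patternEvent σ)]
        refine Finset.sum_congr rfl fun σ _ => ?_
        rw [lintegral_indicator (h.measurableSet_patternEvent σ)]
        exact h.lintegral_patternEvent hX σ (he σ)
    _ = ∫⁻ ω, ∑ σ : UpperPair n → Bool, ENNReal.ofReal (patternWeight σ fun i => X i ω) *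
        ENNReal.ofReal (e σ fun i => X i ω) ∂μ := by
        rw [lintegral_finsetSum]
        exact fun σ _ => (ENNReal.measurable_ofReal.comp
          ((measurable_patternWeight σ).comp hXm)).mul ((he σ).comp hXm)
    _ ≤ ∫⁻ _, 1 ∂μ := by
        refine lintegral_mono_ae (hX.mono fun ω hω => ?_)
        have hnn : ∀ σ : UpperPair n → Bool, 0 ≤ patternWeight σ fun i => X i ω := fun σ =>
          patternWeight_nonneg σ hω
        simp_rw [← ENNReal.ofReal_mul (hnn _)]
        rw [← ENNReal.ofReal_sum_of_nonneg fun σ _ => mul_nonneg (hnn σ) (Real.exp_pos _).le]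
        rw [← ENNReal.ofReal_one]
        refine ENNReal.ofReal_le_ofReal ?_
        exact sum_bernoulliWeight_mul_exp_le (fun q : UpperPair n => inner ℝ (X q.1.1 ω) (X q.1.2 ω))
          (c fun i => X i ω) fun q => hω _ _
    _ = 1 := by simp

/-- One-sided version of `IsRDPG.hoeffding`. -/
theorem IsRDPG.hoeffding_one_sided [IsProbabilityMeasure μ] (h : IsRDPG μ F X A)
    (hX : ∀ᵐ ω ∂μ, ∀ i j, inner ℝ (X i ω) (X j ω) ∈ Set.Icc (0 : ℝ) 1)
    {c : (Fin n → EuclideanSpace ℝ (Fin d)) → UpperPair n → ℝ} (hc : ∀ q, Measurable (c · q))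
    {t : ℝ} (ht : 0 ≤ t) :
    μ.real {ω | t * √(∑ q, c (fun i => X i ω) q ^ 2) < ∑ q : UpperPair n, c (fun i => X i ω) q *
      (A ω q.1.1 q.1.2 - inner ℝ (X q.1.1 ω) (X q.1.2 ω))} ≤ Real.exp (-(2 * t ^ 2)) := by
  have hXm := h.measurable_positions
  let b : (Fin n → EuclideanSpace ℝ (Fin d)) → UpperPair n → ℝ := fun x q =>
    4 * t / √(∑ q, c x q ^ 2) * c x q
  have hb : ∀ q, Measurable (b · q) := fun q =>
    (measurable_const.div (Real.continuous_sqrt.measurable.comp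
      (Finset.measurable_sum _ fun q _ => (hc q).pow_const 2))).mul (hc q)
  have h1 := h.lintegral_exp_le_one hX hb
  set f : Ω → ENNReal := fun ω => ENNReal.ofReal (Real.exp (∑ q : UpperPair n,
    b (fun i => X i ω) q * (A ω q.1.1 q.1.2 - inner ℝ (X q.1.1 ω) (X q.1.2 ω)) -
        (∑ q, b (fun i => X i ω) q ^ 2) / 8)) with hf
  have hfm : Measurable f := by
    refine ENNReal.measurable_ofReal.comp (Real.measurable_exp.comp ?_)
    refine Measurable.sub (Finset.measurable_sum _ fun q _ => ?_)
      (Measurable.div_const (Finset.measurable_sum _ fun q _ =>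
        ((hb q).comp hXm).pow_const 2) _)
    exact ((hb q).comp hXm).mul ((h.measurable_adj _ _).sub
      ((h.measurable_latent _).inner (h.measurable_latent _)))
  have hsub : {ω | t * √(∑ q, c (fun i => X i ω) q ^ 2) <
      ∑ q : UpperPair n, c (fun i => X i ω) q *
      (A ω q.1.1 q.1.2 - inner ℝ (X q.1.1 ω) (X q.1.2 ω))} ⊆
      {ω | ENNReal.ofReal (Real.exp (2 * t ^ 2)) ≤ f ω} := by
    intro ω hω
    simp only [Set.mem_ofPred_eq] at hω ⊢
    rw [hf]
    refine ENNReal.ofReal_le_ofReal (Real.exp_le_exp.2 ?_)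
    simp only [b]
    generalize (c fun i => X i ω) = c' at *
    have hS0 : 0 ≤ ∑ q, c' q ^ 2 := by positivity
    have hS : 0 < √(∑ q, c' q ^ 2) := by
      rw [Real.sqrt_pos]
      refine lt_of_le_of_ne hS0 fun h0 => ?_
      have hz : ∀ q, c' q = 0 := fun q => by
        have := (Finset.sum_eq_zero_iff_of_nonneg (fun q _ => sq_nonneg (c' q))).1 h0.symm q
          (Finset.mem_univ q)
        simpa using this
      simp [hz] at hω
    set s := √(∑ q, c' q ^ 2) with hs
    have hs2 : s ^ 2 = ∑ q, c' q ^ 2 := Real.sq_sqrt hS0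
    have e1 : ∑ q, (4 * t / s * c' q) ^ 2 = 16 * t ^ 2 := by
      simp_rw [mul_pow]
      rw [← Finset.mul_sum, ← hs2]
      field_simp
      ring
    simp_rw [mul_assoc (4 * t / s)]
    rw [e1, ← Finset.mul_sum]
    have e2 := mul_le_mul_of_nonneg_left hω.le (show 0 ≤ 4 * t / s by positivity)
    have e3 : 4 * t / s * (t * s) = 4 * t ^ 2 := by field_simp
    linarith
  have h2 := mul_meas_ge_le_lintegral₀ (μ := μ) hfm.aemeasurable
    (ENNReal.ofReal (Real.exp (2 * t ^ 2)))
  have h3 := h2.trans h1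
  have h4 := ENNReal.toReal_mono ENNReal.one_ne_top h3
  rw [ENNReal.toReal_mul, ENNReal.toReal_ofReal (Real.exp_pos _).le, ENNReal.toReal_one] at h4
  refine (measureReal_mono hsub).trans ?_
  rw [Real.exp_neg, ← one_div, le_div_iff₀ (Real.exp_pos _), mul_comm]
  exact h4

/-- Hoeffding's inequality for a linear form in the centered edges, whose coefficients may depend
on the latent positions. -/
theorem IsRDPG.hoeffding [IsProbabilityMeasure μ] (h : IsRDPG μ F X A)
    (hX : ∀ᵐ ω ∂μ, ∀ i j, inner ℝ (X i ω) (X j ω) ∈ Set.Icc (0 : ℝ) 1)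
    {c : (Fin n → EuclideanSpace ℝ (Fin d)) → UpperPair n → ℝ} (hc : ∀ q, Measurable (c · q))
    {t : ℝ} (ht : 0 ≤ t) :
    μ.real {ω | t * √(∑ q, c (fun i => X i ω) q ^ 2) < |∑ q : UpperPair n, c (fun i => X i ω) q *
      (A ω q.1.1 q.1.2 - inner ℝ (X q.1.1 ω) (X q.1.2 ω))|} ≤ 2 * Real.exp (-(2 * t ^ 2)) := by
  have h1 := h.hoeffding_one_sided hX hc ht
  have h2 := h.hoeffding_one_sided hX (c := fun x q => -c x q) (fun q => (hc q).neg) ht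
  simp only [neg_sq, neg_mul, Finset.sum_neg_distrib] at h2
  rw [two_mul]
  refine le_trans (le_trans (measureReal_mono ?_) (measureReal_union_le _ _)) (add_le_add h1 h2)
  intro ω hω
  simp only [Set.mem_ofPred_eq, Set.mem_union, lt_abs] at hω ⊢
  exact hω

end RDPG

/-! ### Bilinear forms of symmetric matrices -/

theorem sum_sum_eq_sum_upperPair_add {n : ℕ} (f : Fin n → Fin n → ℝ) :
    ∑ i, ∑ j, f i j =
      ∑ q : UpperPair n, (f q.1.1 q.1.2 + f q.1.2 q.1.1) + ∑ i, f i i := by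
  have h1 : ∀ i, ∑ j, f i j = ∑ j ∈ Finset.Ioi i, f i j + ∑ j ∈ Finset.Iio i, f i j + f i i := by
    intro i
    rw [add_assoc, Finset.sum_Iio_add_eq_sum_Iic, add_comm, ← Finset.sum_union]
    · congr 1
      ext j
      simp [le_or_gt]
    · rw [Finset.disjoint_left]
      intro j hj hj'
      exact absurd (Finset.mem_Iic.1 hj) (not_le.2 (Finset.mem_Ioi.1 hj'))
  have h2 : ∑ i, ∑ j ∈ Finset.Iio i, f i j = ∑ i, ∑ j ∈ Finset.Ioi i, f j i :=
    Finset.sum_comm' (by simp)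
  rw [Finset.sum_congr rfl fun i _ => h1 i, Finset.sum_add_distrib, Finset.sum_add_distrib, h2,
    sum_upperPair, sum_upperPair fun i j => f j i, ← Finset.sum_add_distrib]

theorem dotProduct_mulVec_eq_sum_upperPair {n : ℕ} {M : Matrix (Fin n) (Fin n) ℝ}
    (hM : M.IsSymm) (u v : Fin n → ℝ) :
    u ⬝ᵥ (M *ᵥ v) = ∑ q : UpperPair n, (u q.1.1 * v q.1.2 + u q.1.2 * v q.1.1) * M q.1.1 q.1.2 +
      ∑ i, u i * v i * M i i := by
  have h1 : u ⬝ᵥ (M *ᵥ v) = ∑ i, ∑ j, u i * v j * M i j := by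
    simp only [dotProduct, Matrix.mulVec, Finset.mul_sum]
    exact Finset.sum_congr rfl fun i _ => Finset.sum_congr rfl fun j _ => by ring
  rw [h1, sum_sum_eq_sum_upperPair_add]
  congr 1
  refine Finset.sum_congr rfl fun q _ => ?_
  rw [hM.apply q.1.1 q.1.2]
  ring

theorem sum_upperPair_sq_le {n : ℕ} (u v : Fin n → ℝ) :
    ∑ q : UpperPair n, (u q.1.1 * v q.1.2 + u q.1.2 * v q.1.1) ^ 2 ≤
      2 * ((u ⬝ᵥ u) * (v ⬝ᵥ v)) := by
  have h1 : (u ⬝ᵥ u) * (v ⬝ᵥ v) = ∑ i, ∑ j, (u i * v j) ^ 2 := by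
    simp only [dotProduct, Finset.sum_mul_sum]
    exact Finset.sum_congr rfl fun i _ => Finset.sum_congr rfl fun j _ => by ring
  rw [h1, sum_sum_eq_sum_upperPair_add, mul_add, Finset.mul_sum]
  have h2 : 0 ≤ 2 * ∑ i, (u i * v i) ^ 2 := by positivity
  refine le_trans (Finset.sum_le_sum fun q _ => ?_) (le_add_of_nonneg_right h2)
  nlinarith [sq_nonneg (u q.1.1 * v q.1.2 - u q.1.2 * v q.1.1)]

theorem abs_sum_mul_mul_le {n : ℕ} (u v b : Fin n → ℝ) (hb : ∀ i, |b i| ≤ 1) :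
    |∑ i, u i * v i * b i| ≤ √(u ⬝ᵥ u) * √(v ⬝ᵥ v) := by
  have h1 : ∑ i, u i * v i * b i = u ⬝ᵥ fun i => v i * b i :=
    Finset.sum_congr rfl fun i _ => by ring
  rw [h1]
  refine (abs_dotProduct_le _ _).trans (mul_le_mul_of_nonneg_left ?_ (Real.sqrt_nonneg _))
  refine Real.sqrt_le_sqrt (Finset.sum_le_sum fun i _ => ?_)
  have := (sq_le_one_iff_abs_le_one _).2 (hb i)
  nlinarith [sq_nonneg (v i)]

theorem abs_dotProduct_mulVec_le_of_sum_sq_le {d : ℕ} {B : Matrix (Fin d) (Fin d) ℝ} {r : ℝ}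
    (hr : 0 ≤ r) (hB : ∑ k, ∑ l, B k l ^ 2 ≤ r ^ 2) (w : Fin d → ℝ) :
    |w ⬝ᵥ (B *ᵥ w)| ≤ r * (w ⬝ᵥ w) := by
  have hw : 0 ≤ w ⬝ᵥ w := Finset.sum_nonneg fun j _ => mul_self_nonneg _
  refine abs_le_of_sq_le_sq ?_ (by positivity)
  have h1 : w ⬝ᵥ (B *ᵥ w) = ∑ z : Fin d × Fin d, B z.1 z.2 * (w z.1 * w z.2) := by
    rw [Fintype.sum_prod_type]
    simp only [dotProduct, Matrix.mulVec, Finset.mul_sum]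
    exact Finset.sum_congr rfl fun i _ => Finset.sum_congr rfl fun j _ => by ring
  have h2 : (w ⬝ᵥ w) ^ 2 = ∑ z : Fin d × Fin d, (w z.1 * w z.2) ^ 2 := by
    rw [Fintype.sum_prod_type, sq]
    simp only [dotProduct, Finset.sum_mul_sum]
    exact Finset.sum_congr rfl fun i _ => Finset.sum_congr rfl fun j _ => by ring
  rw [h1, mul_pow, h2]
  refine (Finset.sum_mul_sq_le_sq_mul_sq _ _ _).trans ?_
  refine mul_le_mul_of_nonneg_right ?_ (by positivity)
  rwa [Fintype.sum_prod_type]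

/-! ### The bound on the event where all concentration inequalities hold -/

section Deterministic

variable {n d : ℕ} {x : Fin n → EuclideanSpace ℝ (Fin d)} {A : Matrix (Fin n) (Fin n) ℝ}

theorem probMatrix_apply (x : Fin n → EuclideanSpace ℝ (Fin d)) (i j : Fin n) :
    probMatrix x i j = inner ℝ (x i) (x j) := by
  simp only [probMatrix, Matrix.mul_apply, latentMatrix, Matrix.of_apply, Matrix.transpose_apply,
    PiLp.inner_apply, RCLike.inner_apply, conj_trivial]
  exact Finset.sum_congr rfl fun k _ => mul_comm _ _

theorem isSymm_probMatrix (x : Fin n → EuclideanSpace ℝ (Fin d)) : (probMatrix x).IsSymm := by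
  ext i j
  rw [Matrix.transpose_apply, probMatrix_apply, probMatrix_apply, real_inner_comm]

theorem abs_adj_sub_probMatrix_diag_le (hx : ∀ i j, inner ℝ (x i) (x j) ∈ Set.Icc (0 : ℝ) 1)
    (hA0 : ∀ i, A i i = 0) (i : Fin n) : |(A - probMatrix x) i i| ≤ 1 := by
  rw [Matrix.sub_apply, hA0, probMatrix_apply, zero_sub, abs_neg, abs_of_nonneg (hx i i).1]
  exact (hx i i).2

/-- The operator norm of the noise, from its values on a norming set. -/
theorem abs_noise_le_of_norming (hx : ∀ i j, inner ℝ (x i) (x j) ∈ Set.Icc (0 : ℝ) 1)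
    (hA : A.IsSymm) (hA0 : ∀ i, A i i = 0) {N : Finset (Fin n → ℝ)}
    (hN1 : ∀ u ∈ N, u ⬝ᵥ u ≤ 1)
    (hN : ∀ (b : Fin n → ℝ) (τ : ℝ), (∀ u ∈ N, |u ⬝ᵥ b| ≤ τ) → √(b ⬝ᵥ b) ≤ 2 * τ)
    {t : ℝ} (ht : 0 ≤ t)
    (h : ∀ u ∈ N, ∀ v ∈ N,
      |∑ q : UpperPair n, (u q.1.1 * v q.1.2 + u q.1.2 * v q.1.1) *
        (A q.1.1 q.1.2 - inner ℝ (x q.1.1) (x q.1.2))| ≤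
      t * √(∑ q : UpperPair n, (u q.1.1 * v q.1.2 + u q.1.2 * v q.1.1) ^ 2))
    (y z : Fin n → ℝ) :
    |y ⬝ᵥ ((A - probMatrix x) *ᵥ z)| ≤ 4 * (t * √2 + 1) * √(y ⬝ᵥ y) * √(z ⬝ᵥ z) := by
  refine abs_dotProduct_mulVec_le_of_norming hN (fun u hu v hv => ?_) y z
  rw [dotProduct_mulVec_eq_sum_upperPair (hA.sub (isSymm_probMatrix x))]
  have hu0 : 0 ≤ u ⬝ᵥ u := Finset.sum_nonneg fun j _ => mul_self_nonneg _
  have hv0 : 0 ≤ v ⬝ᵥ v := Finset.sum_nonneg fun j _ => mul_self_nonneg _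
  refine (abs_add_le _ _).trans (add_le_add ?_ ?_)
  · simp only [Matrix.sub_apply, probMatrix_apply]
    refine (h u hu v hv).trans (mul_le_mul_of_nonneg_left (Real.sqrt_le_sqrt ?_) ht)
    refine (sum_upperPair_sq_le u v).trans ?_
    have := mul_le_one₀ (hN1 u hu) hv0 (hN1 v hv)
    linarith
  · refine (abs_sum_mul_mul_le u v _ (abs_adj_sub_probMatrix_diag_le hx hA0)).trans ?_
    have h1 : √(u ⬝ᵥ u) ≤ 1 := Real.sqrt_le_one.2 (hN1 u hu)
    have h2 : √(v ⬝ᵥ v) ≤ 1 := Real.sqrt_le_one.2 (hN1 v hv)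
    exact mul_le_one₀ h1 (Real.sqrt_nonneg _) h2

/-- The noise on the range of the latent matrix. -/
theorem abs_noise_le_on_range (hx : ∀ i j, inner ℝ (x i) (x j) ∈ Set.Icc (0 : ℝ) 1)
    (hA : A.IsSymm) (hA0 : ∀ i, A i i = 0) {t : ℝ} (ht : 0 ≤ t)
    (h : ∀ k l : Fin d,
      |∑ q : UpperPair n, (x q.1.1 k * x q.1.2 l + x q.1.2 k * x q.1.1 l) *
        (A q.1.1 q.1.2 - inner ℝ (x q.1.1) (x q.1.2))| ≤
      t * √(∑ q : UpperPair n, (x q.1.1 k * x q.1.2 l + x q.1.2 k * x q.1.1 l) ^ 2))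
    (w : Fin d → ℝ) :
    |(latentMatrix x *ᵥ w) ⬝ᵥ ((A - probMatrix x) *ᵥ (latentMatrix x *ᵥ w))| ≤
      √2 * t * n * (w ⬝ᵥ w) + (latentMatrix x *ᵥ w) ⬝ᵥ (latentMatrix x *ᵥ w) := by
  set M := A - probMatrix x with hM
  have hMs : M.IsSymm := hA.sub (isSymm_probMatrix x)
  set M₀ := M - Matrix.diagonal (fun i => M i i) with hM₀
  have hM₀s : M₀.IsSymm := hMs.sub (Matrix.isSymm_diagonal _)
  set Y := latentMatrix x with hY
  set u := Y *ᵥ w with hu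
  have hsplit : u ⬝ᵥ (M *ᵥ u) = w ⬝ᵥ ((Yᵀ * M₀ * Y) *ᵥ w) + ∑ i, u i * u i * M i i := by
    have e1 : M = M₀ + Matrix.diagonal (fun i => M i i) := by rw [hM₀]; abel
    have e2 : u ⬝ᵥ (M₀ *ᵥ u) = w ⬝ᵥ ((Yᵀ * M₀ * Y) *ᵥ w) := by
      rw [← Matrix.mulVec_mulVec, ← Matrix.mulVec_mulVec, ← hu, Matrix.dotProduct_mulVec w,
        ← Matrix.mulVec_transpose, Matrix.transpose_transpose]
    rw [← e2]
    conv_lhs => rw [e1, Matrix.add_mulVec, dotProduct_add]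
    congr 1
    simp only [dotProduct, Matrix.mulVec_diagonal]
    exact Finset.sum_congr rfl fun i _ => by ring
  have hB : ∀ k l, (Yᵀ * M₀ * Y) k l ^ 2 ≤
      t ^ 2 * (2 * ((∑ i, x i k ^ 2) * ∑ i, x i l ^ 2)) := by
    intro k l
    have e1 : (Yᵀ * M₀ * Y) k l = (fun i => x i k) ⬝ᵥ (M₀ *ᵥ fun i => x i l) := by
      rw [Matrix.mul_assoc, Matrix.mul_apply]
      simp only [dotProduct, Matrix.mulVec, Matrix.mul_apply, Matrix.transpose_apply, hY,
        latentMatrix, Matrix.of_apply]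
    have e2 : ∀ q : UpperPair n, M₀ q.1.1 q.1.2 =
        A q.1.1 q.1.2 - inner ℝ (x q.1.1) (x q.1.2) := by
      intro q
      simp [hM₀, hM, Matrix.diagonal_apply_ne _ q.2.ne, probMatrix_apply]
    have e3 : ∀ i, M₀ i i = 0 := fun i => by simp [hM₀]
    rw [e1, dotProduct_mulVec_eq_sum_upperPair hM₀s]
    simp only [e2, e3, mul_zero, Finset.sum_const_zero, add_zero]
    have e4 := h k l
    rw [← sq_abs]
    refine (pow_le_pow_left₀ (abs_nonneg _) e4 2).trans ?_
    rw [mul_pow, Real.sq_sqrt (by positivity)]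
    refine mul_le_mul_of_nonneg_left ?_ (sq_nonneg _)
    have e5 := sum_upperPair_sq_le (fun i => x i k) (fun i => x i l)
    simp only [dotProduct, ← sq] at e5
    exact e5
  have hfro : ∑ k, ∑ l, (Yᵀ * M₀ * Y) k l ^ 2 ≤ (√2 * t * n) ^ 2 := by
    have e1 : ∑ k, ∑ i, x i k ^ 2 ≤ (n : ℝ) := by
      rw [Finset.sum_comm]
      calc ∑ i, ∑ k, x i k ^ 2 ≤ ∑ _i : Fin n, (1 : ℝ) := by
            refine Finset.sum_le_sum fun i _ => ?_
            have := (hx i i).2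
            rw [real_inner_self_eq_norm_sq, EuclideanSpace.real_norm_sq_eq] at this
            exact this
        _ = n := by simp
    have e0 : 0 ≤ ∑ k, ∑ i, x i k ^ 2 := by positivity
    calc ∑ k, ∑ l, (Yᵀ * M₀ * Y) k l ^ 2
        ≤ ∑ k, ∑ l, t ^ 2 * (2 * ((∑ i, x i k ^ 2) * ∑ i, x i l ^ 2)) :=
          Finset.sum_le_sum fun k _ => Finset.sum_le_sum fun l _ => hB k l
      _ = t ^ 2 * (2 * (∑ k, ∑ i, x i k ^ 2) ^ 2) := by
          rw [sq (∑ k, ∑ i, x i k ^ 2), Finset.sum_mul_sum]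
          simp only [Finset.mul_sum]
      _ ≤ t ^ 2 * (2 * (n : ℝ) ^ 2) := by gcongr
      _ = (√2 * t * n) ^ 2 := by
          rw [mul_pow, mul_pow, Real.sq_sqrt (by norm_num)]; ring
  rw [hsplit]
  refine (abs_add_le _ _).trans (add_le_add ?_ ?_)
  · exact abs_dotProduct_mulVec_le_of_sum_sq_le (by positivity) hfro w
  · refine (abs_sum_mul_mul_le u u _ (abs_adj_sub_probMatrix_diag_le hx hA0)).trans ?_
    exact (Real.mul_self_sqrt (Finset.sum_nonneg fun j _ => mul_self_nonneg _)).le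

/-- The eigenvalue bound in the regime where the signal dominates the noise. -/
theorem norm_topEigenvalues_sub_le (hdn : d ≤ n) (hd : 0 < d)
    (hx : ∀ i j, inner ℝ (x i) (x j) ∈ Set.Icc (0 : ℝ) 1)
    (hA : A.IsSymm) (hA0 : ∀ i, A i i = 0) {N : Finset (Fin n → ℝ)}
    (hN1 : ∀ u ∈ N, u ⬝ᵥ u ≤ 1)
    (hN : ∀ (b : Fin n → ℝ) (τ : ℝ), (∀ u ∈ N, |u ⬝ᵥ b| ≤ τ) → √(b ⬝ᵥ b) ≤ 2 * τ)
    {δ L : ℝ} (hδ0 : 0 < δ) (hδ1 : δ ≤ 1) (hL : 1 ≤ L) (hreg : 20000 * (d * L) ≤ n * δ ^ 2)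
    (hnet : ∀ u ∈ N, ∀ v ∈ N,
      |∑ q : UpperPair n, (u q.1.1 * v q.1.2 + u q.1.2 * v q.1.1) *
        (A q.1.1 q.1.2 - inner ℝ (x q.1.1) (x q.1.2))| ≤
      √(2 * n + L) * √(∑ q : UpperPair n, (u q.1.1 * v q.1.2 + u q.1.2 * v q.1.1) ^ 2))
    (hrange : ∀ k l : Fin d,
      |∑ q : UpperPair n, (x q.1.1 k * x q.1.2 l + x q.1.2 k * x q.1.1 l) *
        (A q.1.1 q.1.2 - inner ℝ (x q.1.1) (x q.1.2))| ≤
      √(2 * L) * √(∑ q : UpperPair n, (x q.1.1 k * x q.1.2 l + x q.1.2 k * x q.1.1 l) ^ 2))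
    (hgram : ∀ w : Fin d → ℝ,
      n * δ / 2 * (w ⬝ᵥ w) ≤ (latentMatrix x *ᵥ w) ⬝ᵥ (latentMatrix x *ᵥ w))
    {S Shat : Matrix (Fin d) (Fin d) ℝ} (hS : IsTopEigenvalueMatrix hdn (probMatrix x) S)
    (hShat : IsTopEigenvalueMatrix hdn A Shat) :
    ‖S - Shat‖ ≤ 40000 * (δ ^ 2)⁻¹ * d * L := by
  have hd1 : (1 : ℝ) ≤ d := by exact_mod_cast hd
  have hn0 : (0 : ℝ) ≤ n := Nat.cast_nonneg n
  have hdL : L ≤ d * L := le_mul_of_one_le_left (by linarith) hd1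
  have hδ2 : δ ^ 2 ≤ 1 := pow_le_one₀ hδ0.le hδ1
  have hnL : 20000 * L ≤ n * δ ^ 2 := by linarith
  have hnn : n * δ ^ 2 ≤ n := mul_le_of_le_one_right hn0 hδ2
  have hn : (20000 : ℝ) ≤ n := by linarith
  set s := √(n : ℝ) with hs
  have hs0 : 0 < s := Real.sqrt_pos.2 (by linarith)
  have hs2 : s ^ 2 = n := Real.sq_sqrt hn0
  have hs1 : 100 ≤ s := by nlinarith
  have hsδ : 112 ≤ s * δ := by
    have : (112 : ℝ) ^ 2 ≤ (s * δ) ^ 2 := by rw [mul_pow, hs2]; linarith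
    exact (sq_le_sq₀ (by norm_num) (by positivity)).1 this
  have hL0 : 0 ≤ L := by linarith
  set m := n * δ / 2 with hm
  have hm0 : 0 < m := by rw [hm]; positivity
  have hms : m = s * (s * δ) / 2 := by rw [hm, ← hs2]; ring
  have hE : ∀ y z : Fin n → ℝ, |y ⬝ᵥ ((A - probMatrix x) *ᵥ z)| ≤
      14 * s * √(y ⬝ᵥ y) * √(z ⬝ᵥ z) := by
    intro y z
    refine (abs_noise_le_of_norming hx hA hA0 hN1 hN (Real.sqrt_nonneg _) hnet y z).trans ?_
    have e1 : √(2 * n + L) * √2 ≤ 5 / 2 * s := by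
      rw [← Real.sqrt_mul (by positivity)]
      refine Real.sqrt_le_iff.2 ⟨by positivity, ?_⟩
      rw [mul_pow, hs2]
      linarith
    have e2 : 4 * (√(2 * n + L) * √2 + 1) ≤ 14 * s := by linarith
    gcongr
  have hLδ : L ≤ L / δ := by
    rw [le_div_iff₀ hδ0]
    exact mul_le_of_le_one_right hL0 hδ1
  have hβ : ∀ w : Fin d → ℝ,
      |(latentMatrix x *ᵥ w) ⬝ᵥ ((A - probMatrix x) *ᵥ (latentMatrix x *ᵥ w))| ≤
      5 * (L / δ) * ((latentMatrix x *ᵥ w) ⬝ᵥ (latentMatrix x *ᵥ w)) := by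
    intro w
    refine (abs_noise_le_on_range hx hA hA0 (Real.sqrt_nonneg _) hrange w).trans ?_
    have hw : 0 ≤ w ⬝ᵥ w := Finset.sum_nonneg fun j _ => mul_self_nonneg _
    have hg := hgram w
    set Q := (latentMatrix x *ᵥ w) ⬝ᵥ (latentMatrix x *ᵥ w)
    have hQ : 0 ≤ Q := le_trans (by positivity) hg
    have e1 : √2 * √(2 * L) ≤ 2 * L := by
      rw [← Real.sqrt_mul (by norm_num)]
      refine Real.sqrt_le_iff.2 ⟨by positivity, ?_⟩
      nlinarith
    have e2 : √2 * √(2 * L) * n * (w ⬝ᵥ w) ≤ 4 * (L / δ) * Q := by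
      calc √2 * √(2 * L) * n * (w ⬝ᵥ w) ≤ 2 * L * n * (w ⬝ᵥ w) := by gcongr
        _ = 4 * (L / δ) * (m * (w ⬝ᵥ w)) := by rw [hm]; field_simp; ring
        _ ≤ 4 * (L / δ) * Q := by gcongr
    have e3 : 1 * Q ≤ L / δ * Q := mul_le_mul_of_nonneg_right (by linarith) hQ
    linarith
  have hεm : 14 * s ≤ m / 4 := by rw [hms]; nlinarith
  have hβm : 5 * (L / δ) ≤ m / 4 := by
    rw [hm, ← mul_div_assoc, div_le_iff₀ hδ0]
    nlinarith
  obtain ⟨U, hU, p, hP, hp, rfl⟩ := hS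
  obtain ⟨V, hV, a, hAV, ha, rfl⟩ := hShat
  rw [Matrix.diagonal_sub]
  have hγ : 5 * (L / δ) + 2 * (14 * s) ^ 2 / m ≤ 40000 * (δ ^ 2)⁻¹ * L := by
    have e1 : 2 * (14 * s) ^ 2 / m = 784 * (1 / δ) := by
      rw [mul_pow, hs2, hm]
      field_simp
      norm_num
    have e2 : 1 / δ ≤ L / δ := by gcongr
    have e3 : L / δ ≤ (δ ^ 2)⁻¹ * L := by
      rw [div_eq_inv_mul]
      gcongr
      nlinarith
    have e4 : 0 ≤ (δ ^ 2)⁻¹ * L := by positivity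
    rw [e1]
    linarith
  have hb0 : 0 ≤ 40000 * (δ ^ 2)⁻¹ * L := by positivity
  refine (frobenius_norm_diagonal_le hb0 fun k => ?_).trans (le_of_eq (by ring))
  rw [abs_sub_comm]
  exact (abs_leading_eigenvalue_sub_le (X := latentMatrix x) hU hP hp hV hAV ha hm0 hgram hεm hE
    hβ (by positivity) hβm (k := Fin.castLE hdn k) k.2).trans hγ

end Deterministic

/-! ### Concentration of the Gram matrix of the latent positions -/

section SecondMoment

variable {d : ℕ} {F : Measure (EuclideanSpace ℝ (Fin d))} [IsProbabilityMeasure F]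

theorem abs_dotProduct_le_one {u x : Fin d → ℝ} (hu : u ⬝ᵥ u ≤ 1) (hx : x ⬝ᵥ x ≤ 1) :
    |u ⬝ᵥ x| ≤ 1 :=
  (abs_dotProduct_le u x).trans
    (mul_le_one₀ (Real.sqrt_le_one.2 hu) (Real.sqrt_nonneg _) (Real.sqrt_le_one.2 hx))

theorem measurable_dotProduct_mul_dotProduct (u v : Fin d → ℝ) :
    Measurable fun x : EuclideanSpace ℝ (Fin d) => (u ⬝ᵥ x.ofLp) * (v ⬝ᵥ x.ofLp) := by
  unfold dotProduct
  fun_prop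

theorem dotProduct_secondMoment_mulVec (hF : ∀ᵐ x ∂F, x.ofLp ⬝ᵥ x.ofLp ≤ 1) (u v : Fin d → ℝ) :
    u ⬝ᵥ (secondMoment F *ᵥ v) = ∫ x, (u ⬝ᵥ x.ofLp) * (v ⬝ᵥ x.ofLp) ∂F := by
  have hint : ∀ k l, Integrable (fun x : EuclideanSpace ℝ (Fin d) => x k * x l) F := by
    intro k l
    refine Integrable.of_bound (C := 1) (by fun_prop) (hF.mono fun x hx => ?_)
    have h1 : ∀ k, |x k| ≤ 1 := by
      intro k
      have : (Pi.single k (1 : ℝ)) ⬝ᵥ x.ofLp = x k := by simp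
      rw [← this]
      exact abs_dotProduct_le_one (by simp) hx
    rw [Real.norm_eq_abs, abs_mul]
    exact mul_le_one₀ (h1 k) (abs_nonneg _) (h1 l)
  have e1 : ∀ x : EuclideanSpace ℝ (Fin d), (u ⬝ᵥ x.ofLp) * (v ⬝ᵥ x.ofLp) =
      ∑ k, ∑ l, u k * v l * (x k * x l) := by
    intro x
    simp only [dotProduct, Finset.sum_mul_sum]
    exact Finset.sum_congr rfl fun i _ => Finset.sum_congr rfl fun j _ => by ring
  simp_rw [e1]
  rw [integral_finsetSum _ fun k _ => integrable_finsetSum _ fun l _ => (hint k l).const_mul _]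
  simp only [dotProduct, Matrix.mulVec, Finset.mul_sum]
  refine Finset.sum_congr rfl fun k _ => ?_
  rw [integral_finsetSum _ fun l _ => (hint k l).const_mul _]
  refine Finset.sum_congr rfl fun l _ => ?_
  rw [integral_const_mul, secondMoment, Matrix.of_apply]
  ring

theorem exists_secondMoment_spectral (F : Measure (EuclideanSpace ℝ (Fin d))) :
    ∃ U ∈ Matrix.orthogonalGroup (Fin d) ℝ,
      secondMoment F = U * Matrix.diagonal (momentEigenvalues F) * Uᵀ := by
  have h := (secondMoment_isHermitian F)
  refine ⟨h.eigenvectorUnitary, h.eigenvectorUnitary.2, ?_⟩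
  conv_lhs => rw [h.spectral_theorem, Unitary.conjStarAlgAut_apply]
  rfl

theorem le_dotProduct_secondMoment (F : Measure (EuclideanSpace ℝ (Fin d))) {δ : ℝ}
    (hδ : ∀ k, δ ≤ momentEigenvalues F k) (w : Fin d → ℝ) :
    δ * (w ⬝ᵥ w) ≤ w ⬝ᵥ (secondMoment F *ᵥ w) := by
  obtain ⟨U, hU, h⟩ := exists_secondMoment_spectral F
  rw [h, dotProduct_mulVec_spectral, dotProduct_self_eq_sum_sq_transpose_mulVec hU,
    Finset.mul_sum]
  exact Finset.sum_le_sum fun i _ => mul_le_mul_of_nonneg_right (hδ i) (sq_nonneg _)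

theorem momentEigenvalues_le_one (hF : ∀ᵐ x ∂F, x.ofLp ⬝ᵥ x.ofLp ≤ 1) (k : Fin d) :
    momentEigenvalues F k ≤ 1 := by
  obtain ⟨U, hU, h⟩ := exists_secondMoment_spectral F
  obtain ⟨h1, h2⟩ := quadratic_form_eigenvector hU (momentEigenvalues F) k
  rw [← h, dotProduct_secondMoment_mulVec hF] at h1
  rw [← h1]
  set u := U *ᵥ Pi.single k (1 : ℝ)
  have hb : ∀ᵐ x ∂F, ‖(u ⬝ᵥ x.ofLp) * (u ⬝ᵥ x.ofLp)‖ ≤ 1 := hF.mono fun x hx => by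
    have := abs_dotProduct_le_one h2.le hx
    rw [Real.norm_eq_abs, abs_mul]
    exact mul_le_one₀ this (abs_nonneg _) this
  have := norm_integral_le_of_norm_le_const hb
  rw [probReal_univ, mul_one] at this
  exact (le_abs_self _).trans this

end SecondMoment

section Latent

variable {Ω : Type*} [MeasurableSpace Ω] {μ : Measure Ω} [IsProbabilityMeasure μ] {n d : ℕ}
  {F : Measure (EuclideanSpace ℝ (Fin d))} [IsProbabilityMeasure F]
  {X : Fin n → Ω → EuclideanSpace ℝ (Fin d)} {A : Ω → Matrix (Fin n) (Fin n) ℝ}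

/-- Hoeffding's inequality for an entry of the Gram matrix, one-sided. -/
theorem IsRDPG.hoeffding_latent_one_sided (h : IsRDPG μ F X A)
    (hF : ∀ᵐ x ∂F, x.ofLp ⬝ᵥ x.ofLp ≤ 1) {u v : Fin d → ℝ} (hu : u ⬝ᵥ u ≤ 1) (hv : v ⬝ᵥ v ≤ 1)
    {s : ℝ} (hs : 0 ≤ s) :
    μ.real {ω | s < ∑ i, (u ⬝ᵥ (X i ω).ofLp) * (v ⬝ᵥ (X i ω).ofLp) -
      n * (u ⬝ᵥ (secondMoment F *ᵥ v))} ≤ Real.exp (-(s ^ 2 / (2 * n))) := by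
  set g : EuclideanSpace ℝ (Fin d) → ℝ := fun x => (u ⬝ᵥ x.ofLp) * (v ⬝ᵥ x.ofLp) with hg
  have hgm : Measurable g := measurable_dotProduct_mul_dotProduct u v
  have hmean : ∀ i, ∫ ω, g (X i ω) ∂μ = u ⬝ᵥ (secondMoment F *ᵥ v) := by
    intro i
    rw [dotProduct_secondMoment_mulVec hF, ← h.latent_law i,
      integral_map (h.measurable_latent i).aemeasurable hgm.aestronglyMeasurable]
  have hsub : ∀ i, HasSubgaussianMGF (fun ω => g (X i ω) - u ⬝ᵥ (secondMoment F *ᵥ v)) 1 μ := by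
    intro i
    have hb : ∀ᵐ ω ∂μ, g (X i ω) ∈ Set.Icc (-1 : ℝ) 1 := by
      have hFi := hF
      rw [← h.latent_law i] at hFi
      refine (ae_of_ae_map (h.measurable_latent i).aemeasurable hFi).mono fun ω hω => ?_
      rw [Set.mem_Icc, ← abs_le, hg, abs_mul]
      exact mul_le_one₀ (abs_dotProduct_le_one hu hω) (abs_nonneg _)
        (abs_dotProduct_le_one hv hω)
    have := hasSubgaussianMGF_of_mem_Icc (hgm.comp (h.measurable_latent i)).aemeasurable hb
    simp only [Function.comp_apply, hmean] at this
    convert this using 1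
    ext
    norm_num
  have hind : iIndepFun (fun i ω => g (X i ω) - u ⬝ᵥ (secondMoment F *ᵥ v)) μ :=
    h.latent_indep.comp (fun _ x => g x - u ⬝ᵥ (secondMoment F *ᵥ v))
      fun _ => hgm.sub measurable_const
  have key := HasSubgaussianMGF.measure_sum_ge_le_of_iIndepFun hind (s := Finset.univ)
    (fun i _ => hsub i) hs
  refine (measureReal_mono ?_).trans (key.trans (le_of_eq ?_))
  · intro ω hω
    simp only [Set.mem_ofPred_eq] at hω ⊢
    rw [Finset.sum_sub_distrib]
    simpa using hω.le
  · simp [neg_div]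

/-- Hoeffding's inequality for an entry of the Gram matrix. -/
theorem IsRDPG.hoeffding_latent (h : IsRDPG μ F X A)
    (hF : ∀ᵐ x ∂F, x.ofLp ⬝ᵥ x.ofLp ≤ 1) {u v : Fin d → ℝ} (hu : u ⬝ᵥ u ≤ 1) (hv : v ⬝ᵥ v ≤ 1)
    {s : ℝ} (hs : 0 ≤ s) :
    μ.real {ω | s < |∑ i, (u ⬝ᵥ (X i ω).ofLp) * (v ⬝ᵥ (X i ω).ofLp) -
      n * (u ⬝ᵥ (secondMoment F *ᵥ v))|} ≤ 2 * Real.exp (-(s ^ 2 / (2 * n))) := by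
  have h1 := h.hoeffding_latent_one_sided hF hu hv hs
  have h2 := h.hoeffding_latent_one_sided hF (u := -u) (by simpa using hu) hv hs
  simp only [neg_dotProduct, neg_mul, Finset.sum_neg_distrib, mul_neg, sub_neg_eq_add] at h2
  rw [two_mul]
  refine le_trans (le_trans (measureReal_mono ?_) (measureReal_union_le _ _)) (add_le_add h1 h2)
  intro ω hω
  simp only [Set.mem_ofPred_eq, Set.mem_union, lt_abs, neg_sub] at hω ⊢
  rcases hω with hω | hω
  · exact Or.inl hω
  · right; linarith

end Latent

/-- The Gram matrix of the latent positions is bounded from below if it is close to its mean on a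
norming set. -/
theorem le_gram_of_norming {n d : ℕ} {F : Measure (EuclideanSpace ℝ (Fin d))}
    {x : Fin n → EuclideanSpace ℝ (Fin d)} {N : Finset (Fin d → ℝ)}
    (hN : ∀ (b : Fin d → ℝ) (τ : ℝ), (∀ u ∈ N, |u ⬝ᵥ b| ≤ τ) → √(b ⬝ᵥ b) ≤ 2 * τ)
    {δ s : ℝ} (hδ : ∀ k, δ ≤ momentEigenvalues F k) (hs : 4 * s ≤ n * δ / 2)
    (h : ∀ u ∈ N, ∀ v ∈ N, |∑ i, (u ⬝ᵥ (x i).ofLp) * (v ⬝ᵥ (x i).ofLp) -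
      n * (u ⬝ᵥ (secondMoment F *ᵥ v))| ≤ s) (w : Fin d → ℝ) :
    n * δ / 2 * (w ⬝ᵥ w) ≤ (latentMatrix x *ᵥ w) ⬝ᵥ (latentMatrix x *ᵥ w) := by
  set Y := latentMatrix x with hY
  have hrow : ∀ (w : Fin d → ℝ) i, (Y *ᵥ w) i = w ⬝ᵥ (x i).ofLp := by
    intro w i
    rw [dotProduct_comm]
    rfl
  have hquad : ∀ u v : Fin d → ℝ, u ⬝ᵥ ((Yᵀ * Y - (n : ℝ) • secondMoment F) *ᵥ v) =
      (Y *ᵥ u) ⬝ᵥ (Y *ᵥ v) - n * (u ⬝ᵥ (secondMoment F *ᵥ v)) := by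
    intro u v
    rw [Matrix.sub_mulVec, dotProduct_sub, Matrix.smul_mulVec, dotProduct_smul, smul_eq_mul,
      ← Matrix.mulVec_mulVec, Matrix.dotProduct_mulVec u, ← Matrix.mulVec_transpose,
      Matrix.transpose_transpose]
  have h1 := abs_dotProduct_mulVec_le_of_norming hN
    (M := Yᵀ * Y - (n : ℝ) • secondMoment F) (τ := s) (fun u hu v hv => by
      rw [hquad]
      simp only [dotProduct] at hrow ⊢
      simp only [hrow]
      exact h u hu v hv) w w
  have hw : 0 ≤ w ⬝ᵥ w := Finset.sum_nonneg fun j _ => mul_self_nonneg _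
  rw [hquad, mul_assoc, Real.mul_self_sqrt hw] at h1
  have h2 := neg_le_of_abs_le h1
  have h3 := mul_le_mul_of_nonneg_left (le_dotProduct_secondMoment F hδ w)
    (Nat.cast_nonneg (α := ℝ) n)
  have h4 := mul_le_mul_of_nonneg_right hs hw
  linarith

/-! ### The probability of the exceptional events -/

theorem measureReal_exists_pair_le {Ω α : Type*} [MeasurableSpace Ω] (μ : Measure Ω)
    [IsFiniteMeasure μ] (N : Finset α) (B : α → α → Set Ω) {b : ℝ}
    (h : ∀ u ∈ N, ∀ v ∈ N, μ.real (B u v) ≤ b) :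
    μ.real {ω | ∃ u ∈ N, ∃ v ∈ N, ω ∈ B u v} ≤ (N.card : ℝ) ^ 2 * b := by
  have h1 : {ω | ∃ u ∈ N, ∃ v ∈ N, ω ∈ B u v} = ⋃ z ∈ N ×ˢ N, B z.1 z.2 := by
    ext ω
    simp only [Set.mem_ofPred_eq, Set.mem_iUnion, Finset.mem_product, exists_prop, Prod.exists]
    constructor
    · rintro ⟨u, hu, v, hv, hω⟩
      exact ⟨u, v, ⟨hu, hv⟩, hω⟩
    · rintro ⟨u, v, ⟨hu, hv⟩, hω⟩
      exact ⟨u, hu, v, hv, hω⟩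
  rw [h1]
  calc μ.real (⋃ z ∈ N ×ˢ N, B z.1 z.2) ≤ ∑ z ∈ N ×ˢ N, μ.real (B z.1 z.2) :=
        measureReal_biUnion_finset_le _ _
    _ ≤ ∑ _z ∈ N ×ˢ N, b := Finset.sum_le_sum fun z hz =>
        h _ (Finset.mem_product.1 hz).1 _ (Finset.mem_product.1 hz).2
    _ = (N.card : ℝ) ^ 2 * b := by
        rw [Finset.sum_const, Finset.card_product, nsmul_eq_mul]
        push_cast
        ring

/-- The union bound over pairs of points of a net. -/
theorem card_sq_mul_exp_le {p k : ℕ} (hk : k ≤ 5 ^ p) {n : ℕ} (hn : 2 ≤ n) {η : ℝ} (hη0 : 0 < η)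
    (hη : η < 1 / 2) :
    (k : ℝ) ^ 2 * (2 * Real.exp (-(4 * p + 2 * Real.log (n / η)))) ≤ η / 4 := by
  have hn' : (2 : ℝ) ≤ n := by exact_mod_cast hn
  have h1 : (k : ℝ) ^ 2 ≤ Real.exp (4 * p) := by
    have e1 : (k : ℝ) ≤ 5 ^ p := by exact_mod_cast hk
    have e2 : (5 : ℝ) ^ p ≤ Real.exp (2 * p) := by
      rw [mul_comm, Real.exp_nat_mul]
      refine pow_le_pow_left₀ (by norm_num) ?_ p
      have : (2.7 : ℝ) ≤ Real.exp 1 := by linarith [Real.exp_one_gt_d9]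
      have e3 : Real.exp 2 = Real.exp 1 * Real.exp 1 := by rw [← Real.exp_add]; norm_num
      rw [e3]
      nlinarith
    calc (k : ℝ) ^ 2 ≤ (Real.exp (2 * p)) ^ 2 :=
          pow_le_pow_left₀ (Nat.cast_nonneg _) (e1.trans e2) 2
      _ = Real.exp (4 * p) := by rw [← Real.exp_nat_mul]; congr 1; push_cast; ring
  have h2 : Real.exp (-(4 * p + 2 * Real.log (n / η))) = (Real.exp (4 * p))⁻¹ * (η / n) ^ 2 := by
    rw [neg_add, Real.exp_add, Real.exp_neg, ← mul_neg, ← Real.log_inv, inv_div]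
    congr 1
    rw [show (2 : ℝ) * Real.log (η / n) = (2 : ℕ) * Real.log (η / n) by norm_num,
      Real.exp_nat_mul, Real.exp_log (by positivity)]
  rw [h2]
  have h3 : η / n ≤ η / 2 := by gcongr
  have h4 : 0 ≤ η / n := by positivity
  calc (k : ℝ) ^ 2 * (2 * ((Real.exp (4 * p))⁻¹ * (η / n) ^ 2))
      ≤ Real.exp (4 * p) * (2 * ((Real.exp (4 * p))⁻¹ * (η / n) ^ 2)) := by gcongr
    _ = 2 * (η / n) ^ 2 := by field_simp
    _ ≤ 2 * (η / 2) ^ 2 := by gcongr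
    _ ≤ η / 4 := by nlinarith

/-- The union bound over pairs of coordinates. -/
theorem sq_mul_exp_le {d n : ℕ} (hdn : d ≤ n) (hn : 2 ≤ n) {η : ℝ} (hη0 : 0 < η)
    (hη : η < 1 / 2) :
    (d : ℝ) ^ 2 * (2 * Real.exp (-(4 * Real.log (n / η)))) ≤ η / 4 := by
  have hn' : (2 : ℝ) ≤ n := by exact_mod_cast hn
  have hd : (d : ℝ) ≤ n := by exact_mod_cast hdn
  have h2 : Real.exp (-(4 * Real.log (n / η))) = (η / n) ^ 4 := by
    rw [← mul_neg, ← Real.log_inv, inv_div,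
      show (4 : ℝ) * Real.log (η / n) = (4 : ℕ) * Real.log (η / n) by norm_num,
      Real.exp_nat_mul, Real.exp_log (by positivity)]
  rw [h2]
  calc (d : ℝ) ^ 2 * (2 * (η / n) ^ 4) ≤ (n : ℝ) ^ 2 * (2 * (η / n) ^ 4) := by gcongr
    _ = 2 * η ^ 2 * (η / n) ^ 2 := by field_simp
    _ ≤ 2 * η ^ 2 * (η / 2) ^ 2 := by gcongr
    _ ≤ η / 4 := by nlinarith [pow_pos hη0 2, pow_pos hη0 3, mul_pos hη0 hη0]

section Regimes

variable {Ω : Type*} [MeasurableSpace Ω] {μ : Measure Ω} {n d : ℕ}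
  {F : Measure (EuclideanSpace ℝ (Fin d))}
  {X : Fin n → Ω → EuclideanSpace ℝ (Fin d)} {A : Ω → Matrix (Fin n) (Fin n) ℝ}

/-- In the regime of a weak signal the bound follows from the size of the entries. -/
theorem norm_topEigenvalues_sub_le_of_weak_signal {x : Fin n → EuclideanSpace ℝ (Fin d)}
    {M : Matrix (Fin n) (Fin n) ℝ} (hdn : d ≤ n)
    (hx : ∀ i j, inner ℝ (x i) (x j) ∈ Set.Icc (0 : ℝ) 1) (hM : ∀ i j, M i j = 0 ∨ M i j = 1)
    {δ L : ℝ} (hδ0 : 0 < δ) (hreg : n * δ ^ 2 < 20000 * (d * L))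
    {S Shat : Matrix (Fin d) (Fin d) ℝ} (hS : IsTopEigenvalueMatrix hdn (probMatrix x) S)
    (hShat : IsTopEigenvalueMatrix hdn M Shat) :
    ‖S - Shat‖ ≤ 40000 * (δ ^ 2)⁻¹ * d * L := by
  have h1 := hS.norm_le fun i j => by
    rw [probMatrix_apply, abs_of_nonneg (hx i j).1]
    exact (hx i j).2
  have h2 := hShat.norm_le fun i j => by
    rcases hM i j with h | h <;> simp [h]
  have h3 : (n : ℝ) ≤ 20000 * (d * L) / δ ^ 2 := by
    rw [le_div_iff₀ (by positivity)]
    exact hreg.le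
  refine (norm_sub_le S Shat).trans ?_
  have h4 : 40000 * (δ ^ 2)⁻¹ * d * L = 2 * (20000 * (d * L) / δ ^ 2) := by
    field_simp
    ring
  linarith

theorem IsRDPG.ae_inner_mem {𝒳 : Set (EuclideanSpace ℝ (Fin d))}
    (h𝒳 : ∀ x ∈ 𝒳, ∀ y ∈ 𝒳, inner ℝ x y ∈ Set.Icc (0 : ℝ) 1) (hF : ∀ᵐ x ∂F, x ∈ 𝒳)
    (h : IsRDPG μ F X A) :
    ∀ᵐ ω ∂μ, ∀ i j, inner ℝ (X i ω) (X j ω) ∈ Set.Icc (0 : ℝ) 1 := by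
  have h1 : ∀ᵐ ω ∂μ, ∀ i, X i ω ∈ 𝒳 := by
    rw [ae_all_iff]
    intro i
    have hFi := hF
    rw [← h.latent_law i] at hFi
    exact ae_of_ae_map (h.measurable_latent i).aemeasurable hFi
  exact h1.mono fun ω hω i j => h𝒳 _ (hω i) _ (hω j)

/-- The eigenvalue bound holds outside of three exceptional events of small probability. -/
theorem IsRDPG.one_sub_lt_measureReal [IsProbabilityMeasure μ] [IsProbabilityMeasure F]
    (h : IsRDPG μ F X A) (hn : 2 ≤ n) (hd : 0 < d) (hdn : d ≤ n)
    (hX : ∀ᵐ ω ∂μ, ∀ i j, inner ℝ (X i ω) (X j ω) ∈ Set.Icc (0 : ℝ) 1)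
    (hF : ∀ᵐ x ∂F, x.ofLp ⬝ᵥ x.ofLp ≤ 1) {η δ : ℝ} (hη0 : 0 < η) (hη : η < 1 / 2)
    (hδ0 : 0 < δ) (hδ1 : δ ≤ 1) (hδ : ∀ k, δ ≤ momentEigenvalues F k) :
    1 - 2 * η < μ.real {ω | ∀ S Shat : Matrix (Fin d) (Fin d) ℝ,
      IsTopEigenvalueMatrix hdn (probMatrix fun i => X i ω) S →
      IsTopEigenvalueMatrix hdn (A ω) Shat →
      ‖S - Shat‖ ≤ 40000 * (δ ^ 2)⁻¹ * d * Real.log (n / η)} := by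
  set G := {ω | ∀ S Shat : Matrix (Fin d) (Fin d) ℝ,
      IsTopEigenvalueMatrix hdn (probMatrix fun i => X i ω) S →
      IsTopEigenvalueMatrix hdn (A ω) Shat →
      ‖S - Shat‖ ≤ 40000 * (δ ^ 2)⁻¹ * d * Real.log (n / η)} with hG
  set L := Real.log (n / η) with hLdef
  have hn' : (2 : ℝ) ≤ n := by exact_mod_cast hn
  have hL : 1 ≤ L := by
    rw [hLdef, Real.le_log_iff_exp_le (by positivity), le_div_iff₀ hη0]
    nlinarith [Real.exp_one_lt_d9, Real.exp_pos 1]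
  rcases lt_or_ge (n * δ ^ 2) (20000 * (d * L)) with hreg | hreg
  · have hGae : G =ᵐ[μ] Set.univ := by
      refine Filter.eventuallyEq_univ.2 ?_
      exact hX.mono fun ω hω S Shat hS hShat =>
        norm_topEigenvalues_sub_le_of_weak_signal hdn hω (h.adj_zero_or_one ω) hδ0 hreg hS hShat
    rw [measureReal_congr hGae, probReal_univ]
    linarith
  obtain ⟨N, hNc, hN1, hN⟩ := exists_finset_norming n
  obtain ⟨N', hNc', hN1', hN'⟩ := exists_finset_norming d
  have hL0 : 0 ≤ L := by linarith
  set s := √(2 * n * (4 * d + 2 * L)) with hs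
  let c₁ : Fin d → Fin d → (Fin n → EuclideanSpace ℝ (Fin d)) → UpperPair n → ℝ := fun k l x q =>
    x q.1.1 k * x q.1.2 l + x q.1.2 k * x q.1.1 l
  let c₂ : (Fin n → ℝ) → (Fin n → ℝ) → (Fin n → EuclideanSpace ℝ (Fin d)) → UpperPair n → ℝ :=
    fun u v _ q => u q.1.1 * v q.1.2 + u q.1.2 * v q.1.1
  let B₁ : Fin d → Fin d → Set Ω := fun k l => {ω | √(2 * L) * √(∑ q, c₁ k l (fun i => X i ω) q ^ 2)
    < |∑ q : UpperPair n, c₁ k l (fun i => X i ω) q *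
      (A ω q.1.1 q.1.2 - inner ℝ (X q.1.1 ω) (X q.1.2 ω))|}
  let B₂ : (Fin n → ℝ) → (Fin n → ℝ) → Set Ω := fun u v =>
    {ω | √(2 * n + L) * √(∑ q, c₂ u v (fun i => X i ω) q ^ 2)
    < |∑ q : UpperPair n, c₂ u v (fun i => X i ω) q *
      (A ω q.1.1 q.1.2 - inner ℝ (X q.1.1 ω) (X q.1.2 ω))|}
  let B₃ : (Fin d → ℝ) → (Fin d → ℝ) → Set Ω := fun u v =>
    {ω | s < |∑ i, (u ⬝ᵥ (X i ω).ofLp) * (v ⬝ᵥ (X i ω).ofLp) -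
      n * (u ⬝ᵥ (secondMoment F *ᵥ v))|}
  have hB₁ : μ.real {ω | ∃ k ∈ Finset.univ, ∃ l ∈ Finset.univ, ω ∈ B₁ k l} ≤ η / 4 := by
    refine (measureReal_exists_pair_le μ Finset.univ B₁ (b := 2 * Real.exp (-(4 * L)))
      fun k _ l _ => ?_).trans ?_
    · refine (h.hoeffding hX (c := c₁ k l) (fun q => by fun_prop) (Real.sqrt_nonneg _)).trans_eq ?_
      rw [Real.sq_sqrt (by positivity)]
      ring_nf
    · rw [Finset.card_univ, Fintype.card_fin]
      exact sq_mul_exp_le hdn hn hη0 hη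
  have hB₂ : μ.real {ω | ∃ u ∈ N, ∃ v ∈ N, ω ∈ B₂ u v} ≤ η / 4 := by
    refine (measureReal_exists_pair_le μ N B₂ (b := 2 * Real.exp (-(4 * n + 2 * L)))
      fun u _ v _ => ?_).trans (card_sq_mul_exp_le hNc hn hη0 hη)
    refine (h.hoeffding hX (c := c₂ u v) (fun q => measurable_const)
      (Real.sqrt_nonneg _)).trans_eq ?_
    rw [Real.sq_sqrt (by positivity)]
    ring_nf
  have hB₃ : μ.real {ω | ∃ u ∈ N', ∃ v ∈ N', ω ∈ B₃ u v} ≤ η / 4 := by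
    refine (measureReal_exists_pair_le μ N' B₃ (b := 2 * Real.exp (-(4 * d + 2 * L)))
      fun u hu v hv => ?_).trans (card_sq_mul_exp_le hNc' hn hη0 hη)
    refine (h.hoeffding_latent hF (hN1' u hu) (hN1' v hv) (Real.sqrt_nonneg _)).trans_eq ?_
    rw [Real.sq_sqrt (by positivity), mul_div_cancel_left₀ _ (by positivity)]
  have hsm : 4 * s ≤ n * δ / 2 := by
    have hd1 : (1 : ℝ) ≤ d := by exact_mod_cast hd
    have e1 : (4 : ℝ) * d + 2 * L ≤ 6 * (d * L) := by nlinarith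
    have e2 : s ≤ n * δ / 8 := by
      refine Real.sqrt_le_iff.2 ⟨by positivity, ?_⟩
      nlinarith
    linarith
  have hcover : (G ∪ ({ω | ∃ k ∈ Finset.univ, ∃ l ∈ Finset.univ, ω ∈ B₁ k l} ∪
      ({ω | ∃ u ∈ N, ∃ v ∈ N, ω ∈ B₂ u v} ∪ {ω | ∃ u ∈ N', ∃ v ∈ N', ω ∈ B₃ u v})) : Set Ω)
      =ᵐ[μ] (Set.univ : Set Ω) := by
    refine Filter.eventuallyEq_univ.2 (Filter.mem_of_superset hX fun ω hω => ?_)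
    by_contra hnot
    simp only [Set.mem_union, Set.mem_ofPred_eq, not_or, not_exists, not_and, Finset.mem_univ,
      true_imp_iff, B₁, B₂, B₃, not_lt] at hnot
    obtain ⟨hnG, h1, h2, h3⟩ := hnot
    refine hnG fun S Shat hS hShat => ?_
    exact norm_topEigenvalues_sub_le hdn hd hω (h.adj_symm ω) (h.adj_hollow ω) hN1 hN hδ0 hδ1 hL
      hreg h2 h1 (le_gram_of_norming hN' hδ hsm h3) hS hShat
  have h1 : (1 : ℝ) ≤ μ.real G + (η / 4 + (η / 4 + η / 4)) := by
    rw [← probReal_univ (μ := μ), ← measureReal_congr hcover]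
    refine (measureReal_union_le _ _).trans (add_le_add le_rfl ?_)
    refine (measureReal_union_le _ _).trans (add_le_add hB₁ ?_)
    exact (measureReal_union_le _ _).trans (add_le_add hB₂ hB₃)
  linarith

end Regimes

theorem mainTheorem4 :
    ∃ C : ℝ, 0 < C ∧ ∀ c : ℝ, ∃ n₀ : ℕ, ∀ n : ℕ, n₀ < n →
      ∀ η : ℝ, (n : ℝ) ^ (-c) < η → η < 1 / 2 →
      ∀ (d : ℕ) (_ : 0 < d) (hdn : d ≤ n)
        (𝒳 : Set (EuclideanSpace ℝ (Fin d)))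
        (_ : ∀ x ∈ 𝒳, ∀ y ∈ 𝒳, inner ℝ x y ∈ Set.Icc (0 : ℝ) 1)
        (F : Measure (EuclideanSpace ℝ (Fin d))) [IsProbabilityMeasure F]
        (_ : ∀ᵐ x ∂F, x ∈ 𝒳)
        (_ : ∀ k, 0 < momentEigenvalues F k)
        (_ : Function.Injective (momentEigenvalues F))
        {Ω : Type*} [MeasurableSpace Ω] (μ : Measure Ω) [IsProbabilityMeasure μ]
        (X : Fin n → Ω → EuclideanSpace ℝ (Fin d))
        (A : Ω → Matrix (Fin n) (Fin n) ℝ) (_ : IsRDPG μ F X A),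
        1 - 2 * η <
          μ.real {ω | ∀ S Shat : Matrix (Fin d) (Fin d) ℝ,
            IsTopEigenvalueMatrix hdn (probMatrix fun i => X i ω) S →
            IsTopEigenvalueMatrix hdn (A ω) Shat →
            ‖S - Shat‖ ≤
              C * ((⨅ k, momentEigenvalues F k) ^ 2)⁻¹ * d * Real.log (n / η)} := by
  refine ⟨40000, by norm_num, fun c => ⟨1, fun n hn η hηc hη d hd hdn 𝒳 h𝒳 F _ hF hpos _ Ω _ μ _ X
    A h => ?_⟩⟩
  have hη0 : 0 < η := lt_of_le_of_lt (Real.rpow_nonneg (Nat.cast_nonneg n) _) hηc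
  have hF1 : ∀ᵐ x ∂F, x.ofLp ⬝ᵥ x.ofLp ≤ 1 := hF.mono fun x hx => by
    have := (h𝒳 x hx x hx).2
    rwa [← WithLp.toLp_ofLp 2 x, inner_toLp_eq_dotProduct] at this
  have : Nonempty (Fin d) := ⟨⟨0, hd⟩⟩
  obtain ⟨k, hk⟩ := exists_eq_ciInf_of_finite (f := momentEigenvalues F)
  refine h.one_sub_lt_measureReal hn hd hdn (h.ae_inner_mem h𝒳 hF) hF1 hη0 hη ?_ ?_ ?_
  · rw [← hk]
    exact hpos k
  · rw [← hk]
    exact momentEigenvalues_le_one hF1 k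
  · exact fun k => ciInf_le (Set.finite_range _).bddBelow k
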